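/- Let $r_k(x)=\operatorname{sign}\sin(2^k\pi x)$, $k\ge 1$, be the Rademacher functions on $[0,1]$. Let $w_0\equiv 1$ and, for $n=2^{k_1}+\dots+2^{k_s}$ with $k_1>\dots>k_s\ge 0$, let $w_n=\prod_{i=1}^s r_{k_i+1}$ (the Walsh system). Write $(f,w_n)=\int_0^1 f\,w_n\,dx$. For every $1<p\le 2$ there is a constant $C_p<\infty$, depending only on $p$, with the following property. Let $\{I_m\}$ be a finite or countable family of pairwise disjoint intervals (finite or infinite) in $\mathbb{Z}_+=\{0,1,2,\dots\}$, and let $f_m$ be measurable complex-valued functions on $[0,1]$ such that $$\big\|\{f_m\}\big\|_{L^p(l^2)}=\Big(\int_0^1\Big(\sum_m|f_m(x)|^2\Big)^{p/2}dx\Big)^{1/p}<\infty$$ and such that each $f_m$ has its Walsh spectrum in $I_m$, i.e. $(f_m,w_n)=0$ for all $n\in\mathbb{Z}_+\setminus I_m$ (in other words, $f_m=\sum_{n\in I_m}(f_m,w_n)\,w_n$). Then the series $\sum_m f_m$ converges unconditionally in $L^p[0,1]$, and $$\Big\|\sum_m f_m\Big\|_{L^p[0,1]}\le C_p\,\big\|\{f_m\}\big\|_{L^p(l^2)}.$$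 -/

import Mathlib

open MeasureTheory Filter Topology
open scoped ENNReal NNReal

noncomputable section

/-- Lebesgue measure on `[0,1]`. -/
def unitMeasure : Measure ℝ := volume.restrict (Set.Icc (0 : ℝ) 1)

/-- The Rademacher function `r_k(x) = sign (sin (2^k π x))`. -/
def rademacher (k : ℕ) (x : ℝ) : ℝ := Real.sign (Real.sin (2 ^ k * Real.pi * x))

/-- The Walsh function `w_n = ∏ r_{k+1}`, the product being over the exponents `k` in the dyadic
decomposition `n = 2^{k_1} + ⋯ + 2^{k_s}`, `k_1 > ⋯ > k_s ≥ 0`; in particular `w_0 = 1`. -/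
def walsh (n : ℕ) (x : ℝ) : ℝ := ∏ k ∈ n.bitIndices.toFinset, rademacher (k + 1) x

/-- The Walsh coefficient `(f, w_n) = ∫_0^1 f w_n` (the Walsh functions are real-valued). -/
def walshCoeff (f : ℝ → ℂ) (n : ℕ) : ℂ := ∫ x, f x * (walsh n x : ℂ) ∂unitMeasure

/-- The Walsh spectrum of `f`: the set of `n` with `(f, w_n) ≠ 0`. -/
def walshSpectrum (f : ℝ → ℂ) : Set ℕ := {n | walshCoeff f n ≠ 0}

/-- The norm of the family `{f_m}` in `L^p([0,1], l^2)`: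
`(∫_0^1 (∑_m |f_m(x)|^2)^{p/2} dx)^{1/p}`, with values in `[0, ∞]`. -/
def mixedNorm {ι : Type*} (p : ℝ) (f : ι → ℝ → ℂ) : ℝ≥0∞ :=
  (∫⁻ x, (∑' m, ‖f m x‖ₑ ^ (2 : ℕ)) ^ (p / 2) ∂unitMeasure) ^ (1 / p)

end

namespace DyadicWalsh

open Finset

noncomputable section

/-! ### Sums over the dyadic group `({0, …, 2 ^ N - 1}, xor)` -/

/-! The core is a Calderón-Zygmund (Gundy) argument for dyadic martingales with values in `l^2`, run
on the finite group of dyadic intervals of length `2 ^ (-N)` with constants independent of `N`.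

Multiplying by `w_b` translates the Walsh spectrum by xor with `b`. An interval of integers splits
into two pieces, one attached to each end point, and xor with that end point turns the piece into a
union of dyadic blocks `[2 ^ t, 2 ^ (t + 1))`, possibly with `0` (`exists_split_Icc`). The block `t`
carries exactly the `t`-th martingale difference, so projecting onto a union of blocks merely keeps
or deletes differences. Such a projection is local: it leaves zero those points where every
difference vanishes (`wproj_martingale_transform`).

Let `F` have components `w_{b_m} f_m`, so that `|F|` is the `l^2` norm of the family, and stop `F`
when the averages of `|F|` first exceed `lam`. The part after stopping affects the output only on
the exceptional set, whose size the maximal inequality controls. The stopped part is at most `2 *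
lam` on that set and equals `F` elsewhere, and is handled by Parseval and the disjointness of the
spectra. This gives `distribution_sum_wproj_le`; integrating it against `lam ^ (p - 1)` gives the
strong type bound for `1 < p < 2`, while `p = 2` is Parseval alone.

Cell averages, Lebesgue differentiation and Fatou carry the bound to `[0,1]` for finite families.
Applied to finite families outside a large finite set, it yields summability in `L^p`. -/

theorem sum_range_xor {M : Type*} [AddCommMonoid M] {N a : ℕ} (ha : a < 2 ^ N) (f : ℕ → M) :
    ∑ x ∈ range (2 ^ N), f (x ^^^ a) = ∑ x ∈ range (2 ^ N), f x := by
  refine sum_nbij' (· ^^^ a) (· ^^^ a) ?_ ?_ ?_ ?_ ?_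
  · intro x hx; exact mem_range.2 (Nat.xor_lt_two_pow (mem_range.1 hx) ha)
  · intro x hx; exact mem_range.2 (Nat.xor_lt_two_pow (mem_range.1 hx) ha)
  · intro x _; simp
  · intro x _; simp
  · intro x _; rfl

theorem sum_range_xor_left {M : Type*} [AddCommMonoid M] {N a : ℕ} (ha : a < 2 ^ N) (f : ℕ → M) :
    ∑ x ∈ range (2 ^ N), f (a ^^^ x) = ∑ x ∈ range (2 ^ N), f x := by
  rw [← sum_range_xor ha]
  simp [Nat.xor_comm a]

/-! ### The Walsh characters of the dyadic group -/

/-- The value of the `n`-th Walsh function on the `x`-th dyadic interval of length `2 ^ (-N)`. -/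
def wal (N n x : ℕ) : ℝ :=
  ∏ i ∈ range N, if n.testBit i && x.testBit (N - 1 - i) then -1 else 1

/-- Pairing bit `i` of the index with bit `N - 1 - i` of the point is invariant under bit reversal,
so indices and points are interchangeable and `wal` is a bicharacter for xor. -/
theorem wal_comm (N n x : ℕ) : wal N n x = wal N x n := by
  unfold wal
  rw [← prod_range_reflect]
  refine prod_congr rfl fun i hi => ?_
  have : N - 1 - (N - 1 - i) = i := by have := mem_range.1 hi; omega
  rw [this, Bool.and_comm]

theorem wal_xor_left (N n m x : ℕ) : wal N (n ^^^ m) x = wal N n x * wal N m x := by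
  unfold wal
  rw [← prod_mul_distrib]
  refine prod_congr rfl fun i _ => ?_
  rw [Nat.testBit_xor]
  cases n.testBit i <;> cases m.testBit i <;> cases x.testBit (N - 1 - i) <;> simp

theorem wal_xor_right (N n x y : ℕ) : wal N n (x ^^^ y) = wal N n x * wal N n y := by
  rw [wal_comm, wal_xor_left, wal_comm N x, wal_comm N y]

theorem wal_zero_left (N x : ℕ) : wal N 0 x = 1 := by simp [wal]

theorem wal_mul_self (N n x : ℕ) : wal N n x * wal N n x = 1 := by
  rw [← wal_xor_left, Nat.xor_self, wal_zero_left]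

theorem norm_wal (N n x : ℕ) : ‖wal N n x‖ = 1 := by
  have h := congrArg norm (wal_mul_self N n x)
  rw [norm_mul, norm_one] at h
  nlinarith [norm_nonneg (wal N n x)]

theorem sum_wal {N k n : ℕ} (hk : k ≤ N) (hn : n < 2 ^ N) :
    ∑ z ∈ range (2 ^ (N - k)), wal N n z = if n < 2 ^ k then (2 : ℝ) ^ (N - k) else 0 := by
  split_ifs with h
  · rw [sum_congr rfl (g := fun _ => (1 : ℝ))]
    · simp
    · intro z hz
      refine prod_eq_one fun i hi => if_neg ?_
      have hi := mem_range.1 hi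
      rw [Bool.and_eq_true, not_and]
      intro hb hz'
      have h1 : i < k := by
        by_contra hik
        rw [Nat.testBit_lt_two_pow (h.trans_le (Nat.pow_le_pow_right two_pos (not_lt.1 hik)))] at hb
        exact absurd hb (by simp)
      rw [Nat.testBit_lt_two_pow ((mem_range.1 hz).trans_le
        (Nat.pow_le_pow_right two_pos (by omega)))] at hz'
      exact absurd hz' (by simp)
  · obtain ⟨i, hik, hb⟩ : ∃ i ≥ k, n.testBit i = true := by
      by_contra hcon
      push Not at hcon
      exact h (Nat.lt_pow_two_of_testBit n fun i hi => by simpa using hcon i hi)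
    have hiN : i < N := by
      by_contra hc
      rw [Nat.testBit_lt_two_pow (hn.trans_le (Nat.pow_le_pow_right two_pos (not_lt.1 hc)))] at hb
      exact absurd hb (by simp)
    -- Translation by the bit paired with `i` preserves the range and changes the sign of the
    -- character, so the sum equals its own negative.
    have hlt : 2 ^ (N - 1 - i) < 2 ^ (N - k) := Nat.pow_lt_pow_right one_lt_two (by omega)
    have hflip : wal N n (2 ^ (N - 1 - i)) = -1 := by
      unfold wal
      rw [prod_eq_single i]
      · simp [hb]
      · intro j hj hji
        have := mem_range.1 hj
        rw [if_neg]
        simp only [Nat.testBit_two_pow, Bool.and_eq_true, decide_eq_true_eq]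
        omega
      · intro hi; exact absurd (mem_range.2 hiN) hi
    have h2 := sum_range_xor hlt (wal N n)
    simp only [wal_xor_right, hflip, mul_neg_one, sum_neg_distrib] at h2
    linarith

theorem sum_wal_mul_wal {N n m : ℕ} (hn : n < 2 ^ N) (hm : m < 2 ^ N) :
    ∑ x ∈ range (2 ^ N), wal N n x * wal N m x = if n = m then (2 : ℝ) ^ N else 0 := by
  have h := sum_wal (Nat.zero_le N) (Nat.xor_lt_two_pow hn hm)
  simp only [Nat.sub_zero, pow_zero, Nat.lt_one_iff, Nat.xor_eq_zero_iff] at h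
  simpa only [wal_xor_left] using h

/-! ### Walsh coefficients and spectral projections -/

/-- The `n`-th Walsh coefficient of a function on the dyadic group. -/
def wcoeff (N : ℕ) (f : ℕ → ℂ) (n : ℕ) : ℂ :=
  ((2 : ℂ) ^ N)⁻¹ * ∑ y ∈ range (2 ^ N), f y * (wal N n y : ℂ)

open Classical in
/-- The projection onto the functions with Walsh spectrum in `A`. -/
def wproj (N : ℕ) (A : Set ℕ) (f : ℕ → ℂ) (x : ℕ) : ℂ :=
  ∑ n ∈ range (2 ^ N), if n ∈ A then wcoeff N f n * (wal N n x : ℂ) else 0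

theorem wcoeff_sum {ι : Type*} (N : ℕ) (s : Finset ι) (f : ι → ℕ → ℂ) (n : ℕ) :
    wcoeff N (fun x => ∑ i ∈ s, f i x) n = ∑ i ∈ s, wcoeff N (f i) n := by
  simp only [wcoeff, sum_mul, mul_sum]
  rw [sum_comm]

theorem wcoeff_sub (N : ℕ) (f g : ℕ → ℂ) (n : ℕ) :
    wcoeff N (fun x => f x - g x) n = wcoeff N f n - wcoeff N g n := by
  simp only [wcoeff, sub_mul, sum_sub_distrib, mul_sub]

theorem wcoeff_wal_mul {N b : ℕ} (f : ℕ → ℂ) (n : ℕ) :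
    wcoeff N (fun x => (wal N b x : ℂ) * f x) n = wcoeff N f (b ^^^ n) := by
  simp only [wcoeff, wal_xor_left]
  congr 1
  refine sum_congr rfl fun y _ => ?_
  push_cast
  ring

theorem wproj_sum {ι : Type*} (N : ℕ) (A : Set ℕ) (s : Finset ι) (f : ι → ℕ → ℂ) (x : ℕ) :
    wproj N A (fun x => ∑ i ∈ s, f i x) x = ∑ i ∈ s, wproj N A (f i) x := by
  unfold wproj
  rw [sum_comm]
  refine sum_congr rfl fun n _ => ?_
  split_ifs
  · rw [wcoeff_sum, sum_mul]
  · simp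

theorem wproj_sub (N : ℕ) (A : Set ℕ) (f g : ℕ → ℂ) (x : ℕ) :
    wproj N A (fun x => f x - g x) x = wproj N A f x - wproj N A g x := by
  unfold wproj
  rw [← sum_sub_distrib]
  refine sum_congr rfl fun n _ => ?_
  split_ifs
  · rw [wcoeff_sub, sub_mul]
  · simp

theorem wproj_univ {N x : ℕ} (hx : x < 2 ^ N) (f : ℕ → ℂ) : wproj N Set.univ f x = f x := by
  have h : ∀ y ∈ range (2 ^ N), ∑ n ∈ range (2 ^ N), ((wal N n y : ℂ) * (wal N n x : ℂ)) =
      if y = x then (2 : ℂ) ^ N else 0 := by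
    intro y hy
    have := sum_wal_mul_wal (mem_range.1 hy) hx
    simp only [wal_comm N _ x, wal_comm N _ y]
    have h2 := congrArg Complex.ofReal this
    push_cast at h2
    rw [h2]
    split_ifs <;> simp
  simp only [wproj, Set.mem_univ, if_true, wcoeff, mul_sum, sum_mul]
  rw [sum_comm]
  calc _ = ∑ y ∈ range (2 ^ N), ((2 : ℂ) ^ N)⁻¹ * f y *
        ∑ n ∈ range (2 ^ N), ((wal N n y : ℂ) * (wal N n x : ℂ)) := by
        refine sum_congr rfl fun y _ => ?_
        rw [mul_sum]
        exact sum_congr rfl fun n _ => by ring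
    _ = ∑ y ∈ range (2 ^ N), if y = x then f y else 0 := by
        refine sum_congr rfl fun y hy => ?_
        rw [h y hy]
        split_ifs
        · field_simp
        · simp
    _ = f x := by rw [sum_ite_eq' , if_pos (mem_range.2 hx)]

theorem wproj_union {A B : Set ℕ} (h : Disjoint A B) (N : ℕ) (f : ℕ → ℂ) (x : ℕ) :
    wproj N (A ∪ B) f x = wproj N A f x + wproj N B f x := by
  unfold wproj
  rw [← sum_add_distrib]
  refine sum_congr rfl fun n _ => ?_
  by_cases hA : n ∈ A
  · have hB : n ∉ B := Set.disjoint_left.1 h hA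
    rw [if_pos (Set.mem_union_left B hA), if_pos hA, if_neg hB, add_zero]
  · rw [if_neg hA, zero_add]
    by_cases hB : n ∈ B
    · rw [if_pos (Set.mem_union_right A hB), if_pos hB]
    · rw [if_neg hB, if_neg fun h => h.elim hA hB]

theorem wproj_congr {A B : Set ℕ} {N : ℕ} {f : ℕ → ℂ}
    (h : ∀ n < 2 ^ N, wcoeff N f n ≠ 0 → (n ∈ A ↔ n ∈ B)) (x : ℕ) :
    wproj N A f x = wproj N B f x := by
  unfold wproj
  refine sum_congr rfl fun n hn => ?_
  by_cases hc : wcoeff N f n = 0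
  · simp [hc]
  · by_cases hA : n ∈ A
    · rw [if_pos hA, if_pos ((h n (mem_range.1 hn) hc).1 hA)]
    · rw [if_neg hA, if_neg fun hB => hA ((h n (mem_range.1 hn) hc).2 hB)]

theorem wproj_eq_self {A : Set ℕ} {N : ℕ} {f : ℕ → ℂ}
    (h : ∀ n < 2 ^ N, wcoeff N f n ≠ 0 → n ∈ A) {x : ℕ} (hx : x < 2 ^ N) :
    wproj N A f x = f x := by
  rw [wproj_congr (B := Set.univ), wproj_univ hx]
  intro n hn hc
  simp [h n hn hc]

/-- Modulation by a character translates frequencies by xor; this is how a piece of an interval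
becomes a union of blocks. -/
theorem wproj_eq_wal_mul {N b : ℕ} (hb : b < 2 ^ N) (A : Set ℕ) (f : ℕ → ℂ) (x : ℕ) :
    wproj N A f x =
      wal N b x * wproj N {j | b ^^^ j ∈ A} (fun y => (wal N b y : ℂ) * f y) x := by
  have h := wal_mul_self N b x
  have h' : (wal N b x : ℂ) * (wal N b x : ℂ) = 1 := by exact_mod_cast congrArg Complex.ofReal h
  unfold wproj
  rw [← sum_range_xor_left hb, mul_sum]
  refine sum_congr rfl fun n _ => ?_
  rw [wcoeff_wal_mul, wal_xor_left]
  by_cases hA : b ^^^ n ∈ A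
  · rw [if_pos hA, if_pos (show n ∈ {j | b ^^^ j ∈ A} from hA)]
    push_cast; ring
  · rw [if_neg hA, if_neg (show n ∉ {j | b ^^^ j ∈ A} from hA), mul_zero]

/-- Parseval's identity for Walsh polynomials. -/
theorem sum_norm_sq_walsh_poly (N : ℕ) (a : ℕ → ℂ) :
    ∑ x ∈ range (2 ^ N), ‖∑ n ∈ range (2 ^ N), a n * (wal N n x : ℂ)‖ ^ 2 =
      2 ^ N * ∑ n ∈ range (2 ^ N), ‖a n‖ ^ 2 := by
  have key : ∑ x ∈ range (2 ^ N), (∑ n ∈ range (2 ^ N), a n * (wal N n x : ℂ)) *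
      (starRingEnd ℂ) (∑ n ∈ range (2 ^ N), a n * (wal N n x : ℂ)) =
      2 ^ N * ∑ n ∈ range (2 ^ N), a n * (starRingEnd ℂ) (a n) := by
    simp only [map_sum, map_mul, Complex.conj_ofReal, sum_mul_sum]
    rw [sum_comm, mul_sum]
    refine sum_congr rfl fun n hn => ?_
    rw [sum_comm]
    calc _ = ∑ m ∈ range (2 ^ N), a n * (starRingEnd ℂ) (a m) *
          ((∑ x ∈ range (2 ^ N), wal N n x * wal N m x : ℝ) : ℂ) := by
          refine sum_congr rfl fun m _ => ?_
          push_cast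
          rw [mul_sum]
          exact sum_congr rfl fun x _ => by ring
      _ = ∑ m ∈ range (2 ^ N), if n = m then 2 ^ N * (a n * (starRingEnd ℂ) (a m)) else 0 := by
          refine sum_congr rfl fun m hm => ?_
          rw [sum_wal_mul_wal (mem_range.1 hn) (mem_range.1 hm)]
          split_ifs
          · push_cast; ring
          · simp
      _ = _ := by rw [sum_ite_eq, if_pos hn]
  simp only [Complex.mul_conj'] at key
  exact_mod_cast key

theorem sum_norm_sq_eq (N : ℕ) (f : ℕ → ℂ) :
    ∑ x ∈ range (2 ^ N), ‖f x‖ ^ 2 = 2 ^ N * ∑ n ∈ range (2 ^ N), ‖wcoeff N f n‖ ^ 2 := by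
  rw [← sum_norm_sq_walsh_poly]
  refine sum_congr rfl fun x hx => ?_
  rw [← wproj_univ (mem_range.1 hx) f]
  simp [wproj]

/-- Each frequency belongs to at most one `A m`, so Parseval gives the bound without cross terms.
The disjointness of the spectra enters the analysis only here. -/
theorem sum_norm_sq_sum_wproj_le {ι : Type*} [Fintype ι] (N : ℕ) {A : ι → Set ℕ}
    (hA : Pairwise fun m m' => Disjoint (A m) (A m')) (f : ι → ℕ → ℂ) :
    ∑ x ∈ range (2 ^ N), ‖∑ m, wproj N (A m) (f m) x‖ ^ 2 ≤
      ∑ x ∈ range (2 ^ N), ∑ m, ‖f m x‖ ^ 2 := by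
  classical
  have h1 : ∀ x, ∑ m, wproj N (A m) (f m) x = ∑ n ∈ range (2 ^ N),
      (∑ m, if n ∈ A m then wcoeff N (f m) n else 0) * (wal N n x : ℂ) := by
    intro x
    simp only [wproj]
    rw [sum_comm]
    refine sum_congr rfl fun n _ => ?_
    rw [sum_mul]
    refine sum_congr rfl fun m _ => ?_
    split_ifs <;> simp
  simp only [h1]
  rw [sum_norm_sq_walsh_poly, sum_comm]
  rw [sum_congr rfl fun m _ => sum_norm_sq_eq N (f m), ← mul_sum, sum_comm]
  gcongr with n _
  by_cases hn : ∃ m, n ∈ A m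
  · obtain ⟨m, hm⟩ := hn
    rw [sum_eq_single m, if_pos hm]
    · exact single_le_sum (f := fun m => ‖wcoeff N (f m) n‖ ^ 2) (fun i _ => by positivity)
        (mem_univ m)
    · intro m' _ hne
      exact if_neg fun h => Set.disjoint_left.1 (hA hne) h hm
    · simp
  · push Not at hn
    simp only [hn, if_false, sum_const_zero, norm_zero, zero_pow two_ne_zero]
    positivity

/-! ### Conditional expectations on the dyadic group -/

section cexp

variable {V : Type*} [NormedAddCommGroup V] [NormedSpace ℝ V]

/-- The average of `f` over the dyadic interval of level `k` that contains `x`. -/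
def cexp (N k : ℕ) (f : ℕ → V) (x : ℕ) : V :=
  ((2 : ℝ) ^ (N - k))⁻¹ • ∑ z ∈ range (2 ^ (N - k)), f (x ^^^ z)

/-- `f` is constant on the dyadic intervals of level `k`. -/
def IsLevel (N k : ℕ) {W : Type*} (f : ℕ → W) : Prop :=
  ∀ x, ∀ z < 2 ^ (N - k), f (x ^^^ z) = f x

theorem IsLevel.mono {N k l : ℕ} (hkl : k ≤ l) {W : Type*} {f : ℕ → W} (h : IsLevel N k f) :
    IsLevel N l f := fun x z hz =>
  h x z (hz.trans_le (Nat.pow_le_pow_right two_pos (Nat.sub_le_sub_left hkl N)))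

theorem isLevel_cexp (N k : ℕ) (f : ℕ → V) : IsLevel N k (cexp N k f) := by
  intro x z hz
  simp only [cexp, Nat.xor_assoc]
  rw [sum_range_xor_left hz (fun w => f (x ^^^ w))]

theorem cexp_self (N : ℕ) (f : ℕ → V) : cexp N N f = f := by
  ext x; simp [cexp]

theorem cexp_sub (N k : ℕ) (f g : ℕ → V) (x : ℕ) :
    cexp N k (fun y => f y - g y) x = cexp N k f x - cexp N k g x := by
  simp [cexp, smul_sub]

theorem cexp_smul_of_isLevel {N k : ℕ} {c : ℕ → ℝ} (hc : IsLevel N k c) (f : ℕ → V) (x : ℕ) :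
    cexp N k (fun y => c y • f y) x = c x • cexp N k f x := by
  unfold cexp
  rw [smul_comm (c x), smul_sum (r := c x)]
  congr 1
  exact sum_congr rfl fun z hz => by simp only [hc x z (mem_range.1 hz)]

theorem cexp_of_isLevel {N k : ℕ} {f : ℕ → V} (hf : IsLevel N k f) : cexp N k f = f := by
  ext x
  unfold cexp
  rw [sum_congr rfl fun z hz => hf x z (mem_range.1 hz), sum_const, card_range,
    ← Nat.cast_smul_eq_nsmul ℝ, smul_smul]
  simp

theorem cexp_cexp_of_le {N k l : ℕ} (hkl : k ≤ l) (f : ℕ → V) :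
    cexp N k (cexp N l f) = cexp N k f := by
  ext x
  -- Averages commute because xor translations do, and the coarser average is already constant at
  -- level `l`.
  have h : cexp N k (cexp N l f) x = cexp N l (cexp N k f) x := by
    simp only [cexp, ← smul_sum]
    rw [smul_comm, sum_comm]
    simp only [Nat.xor_assoc]
    congr 3
    ext z
    exact sum_congr rfl fun w _ => by rw [Nat.xor_comm z w]
  rw [h, cexp_of_isLevel ((isLevel_cexp N k f).mono hkl)]

theorem sum_cexp {N k : ℕ} (f : ℕ → V) :
    ∑ x ∈ range (2 ^ N), cexp N k f x = ∑ x ∈ range (2 ^ N), f x := by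
  simp only [cexp, ← smul_sum]
  rw [sum_comm, sum_congr rfl (g := fun _ => ∑ x ∈ range (2 ^ N), f x), sum_const, card_range,
    ← Nat.cast_smul_eq_nsmul ℝ, smul_smul]
  · simp
  · intro z hz
    exact sum_range_xor ((mem_range.1 hz).trans_le
      (Nat.pow_le_pow_right two_pos (Nat.sub_le N k))) f

theorem norm_cexp_le (N k : ℕ) (f : ℕ → V) (x : ℕ) :
    ‖cexp N k f x‖ ≤ cexp N k (fun y => ‖f y‖) x := by
  unfold cexp
  rw [norm_smul, Real.norm_of_nonneg (by positivity), smul_eq_mul]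
  gcongr
  exact norm_sum_le _ _

theorem cexp_succ_le {N k : ℕ} (hk : k < N) {u : ℕ → ℝ} (hu : ∀ x, 0 ≤ u x) (x : ℕ) :
    cexp N (k + 1) u x ≤ 2 * cexp N k u x := by
  unfold cexp
  have h1 : N - k = (N - (k + 1)) + 1 := by omega
  rw [smul_eq_mul, smul_eq_mul, h1, pow_succ, mul_inv]
  have h2 : ∑ z ∈ range (2 ^ (N - (k + 1))), u (x ^^^ z) ≤
      ∑ z ∈ range (2 ^ (N - (k + 1) + 1)), u (x ^^^ z) :=
    sum_le_sum_of_subset_of_nonneg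
      (range_subset_range.2 (Nat.pow_le_pow_right two_pos (Nat.le_succ _))) fun i _ _ => hu _
  have h3 : (0 : ℝ) < ((2 : ℝ) ^ (N - (k + 1)))⁻¹ := by positivity
  nlinarith [mul_le_mul_of_nonneg_left h2 h3.le]

end cexp

/-- Averaging is a superposition of translations, hence diagonal on characters, with multiplier the
mean of `wal N n` over the first `2 ^ (N - k)` points. Consequently the differences of successive
averages live on single dyadic blocks. -/
theorem wcoeff_cexp {N k n : ℕ} (hk : k ≤ N) (hn : n < 2 ^ N) (f : ℕ → ℂ) :
    wcoeff N (cexp N k f) n = if n < 2 ^ k then wcoeff N f n else 0 := by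
  have h : ∑ y ∈ range (2 ^ N), cexp N k f y * (wal N n y : ℂ) =
      ((2 : ℂ) ^ (N - k))⁻¹ * (∑ z ∈ range (2 ^ (N - k)), (wal N n z : ℂ)) *
        ∑ y ∈ range (2 ^ N), f y * (wal N n y : ℂ) := by
    have h1 : ∀ z ∈ range (2 ^ (N - k)), ∑ y ∈ range (2 ^ N), f (y ^^^ z) * (wal N n y : ℂ) =
        wal N n z * ∑ y ∈ range (2 ^ N), f y * (wal N n y : ℂ) := by
      intro z hz
      have hz' : z < 2 ^ N := (mem_range.1 hz).trans_le
        (Nat.pow_le_pow_right two_pos (Nat.sub_le N k))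
      rw [← sum_range_xor hz' fun y => f (y ^^^ z) * (wal N n y : ℂ), mul_sum]
      refine sum_congr rfl fun y _ => ?_
      rw [Nat.xor_assoc, Nat.xor_self, Nat.xor_zero, wal_xor_right]
      push_cast
      ring
    simp only [cexp, Complex.real_smul, mul_assoc]
    rw [← mul_sum]
    push_cast
    congr 1
    simp only [sum_mul]
    rw [sum_comm]
    exact sum_congr rfl h1
  have h2 : ∑ z ∈ range (2 ^ (N - k)), (wal N n z : ℂ) =
      if n < 2 ^ k then (2 : ℂ) ^ (N - k) else 0 := by
    have := congrArg (fun r : ℝ => (r : ℂ)) (sum_wal hk hn)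
    push_cast at this
    rw [this]
    split_ifs <;> simp
  simp only [wcoeff, h, h2]
  split_ifs
  · field_simp
  · simp

/-! ### Locality of the spectral projections onto unions of dyadic blocks -/

/-- Membership in `D` depends only on the dyadic block `[2 ^ t, 2 ^ (t + 1))`. -/
def IsBlockUnion (D : Set ℕ) : Prop :=
  ∀ j j', Nat.size j = Nat.size j' → j ∈ D → j' ∈ D

theorem size_eq_of_mem_block {t n : ℕ} (h1 : 2 ^ t ≤ n) (h2 : n < 2 ^ (t + 1)) :
    Nat.size n = t + 1 :=
  le_antisymm (Nat.size_le.2 h2) (Nat.lt_size.2 h1)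

/-- The spectrum of `g` lies in one block, so the projection is either `g` or zero. -/
theorem wproj_martingale_difference {N t : ℕ} (ht : t < N) {D : Set ℕ} (hD : IsBlockUnion D)
    {g : ℕ → ℂ} (h1 : cexp N (t + 1) g = g) (h0 : cexp N t g = 0) {x : ℕ} (hx : x < 2 ^ N)
    (hgx : g x = 0) : wproj N D g x = 0 := by
  have hsupp : ∀ n < 2 ^ N, wcoeff N g n ≠ 0 → Nat.size n = t + 1 := by
    intro n hn hc
    apply size_eq_of_mem_block
    · by_contra hlt
      have := wcoeff_cexp ht.le hn g
      rw [h0, if_pos (not_le.1 hlt)] at this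
      apply hc
      rw [← this]
      simp [wcoeff]
    · by_contra hge
      have := wcoeff_cexp (Nat.succ_le_of_lt ht) hn g
      rw [h1, if_neg hge] at this
      exact hc this
  by_cases hmem : 2 ^ t ∈ D
  · rw [wproj_eq_self _ hx, hgx]
    intro n hn hc
    refine hD (2 ^ t) n ?_ hmem
    rw [hsupp n hn hc, Nat.size_pow]
  · unfold wproj
    refine sum_eq_zero fun n hn => ?_
    by_cases hc : wcoeff N g n = 0
    · simp [hc]
    · refine if_neg fun hnD => hmem (hD n (2 ^ t) ?_ hnD)
      rw [hsupp n (mem_range.1 hn) hc, Nat.size_pow]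

/-- Predictability of `c` makes each summand again a martingale difference of the same level, so
locality applies term by term. -/
theorem wproj_martingale_transform {N : ℕ} {D : Set ℕ} (hD : IsBlockUnion D) {c : ℕ → ℕ → ℝ}
    (hc : ∀ t, IsLevel N t (c t)) (f : ℕ → ℂ) {x : ℕ} (hx : x < 2 ^ N) (hcx : ∀ t < N, c t x = 0) :
    wproj N D (fun y => ∑ t ∈ range N, c t y • (cexp N (t + 1) f y - cexp N t f y)) x = 0 := by
  rw [wproj_sum]
  refine sum_eq_zero fun t ht => ?_
  have ht := mem_range.1 ht
  refine wproj_martingale_difference ht hD ?_ ?_ hx (by simp [hcx t ht])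
  · ext y
    rw [cexp_smul_of_isLevel ((hc t).mono t.le_succ), cexp_sub,
      cexp_cexp_of_le le_rfl, cexp_of_isLevel ((isLevel_cexp N t f).mono t.le_succ)]
  · ext y
    rw [cexp_smul_of_isLevel (hc t), cexp_sub, cexp_cexp_of_le t.le_succ, cexp_cexp_of_le le_rfl]
    simp

/-! ### Stopping a vector-valued dyadic martingale -/

theorem sum_range_ite_sub {V : Type*} [AddCommGroup V] [Module ℝ V] (a : ℕ → V) (s n : ℕ) :
    ∑ t ∈ range n, (if s ≤ t then (1 : ℝ) else 0) • (a (t + 1) - a t) =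
      if s ≤ n then a n - a s else 0 := by
  induction n with
  | zero =>
    rcases Nat.eq_zero_or_pos s with rfl | hs
    · simp
    · simp [hs.ne']
  | succ n ih =>
    rw [sum_range_succ, ih]
    rcases lt_trichotomy s (n + 1) with h | h | h
    · have : s ≤ n := by omega
      simp [this, h.le]
    · simp [h]
    · have h1 : ¬ s ≤ n := by omega
      have h2 : ¬ s ≤ n + 1 := by omega
      simp [h1, h2]

section stopping

variable {V : Type*} [NormedAddCommGroup V] [NormedSpace ℝ V]

open Classical in
/-- The indicator of the event that the averages of `u` exceed `lam` at some level up to `t`. -/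
def exceed (N : ℕ) (u : ℕ → ℝ) (lam : ℝ) (t x : ℕ) : ℝ :=
  if ∃ k ≤ t, lam < cexp N k u x then 1 else 0

theorem isLevel_exceed (N : ℕ) (u : ℕ → ℝ) (lam : ℝ) (t : ℕ) :
    IsLevel N t (exceed N u lam t) := by
  intro x z hz
  unfold exceed
  have h : (∃ k ≤ t, lam < cexp N k u (x ^^^ z)) ↔ ∃ k ≤ t, lam < cexp N k u x := by
    refine exists_congr fun k => and_congr_right fun hk => ?_
    rw [(isLevel_cexp N k u).mono hk x z hz]
  simp only [h]

/-- The martingale part of `F` after the averages of `u` have exceeded `lam`. -/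
def afterExceed (N : ℕ) (u : ℕ → ℝ) (lam : ℝ) (F : ℕ → V) (x : ℕ) : V :=
  ∑ t ∈ range N, exceed N u lam t x • (cexp N (t + 1) F x - cexp N t F x)

/-- At the first exceeding level `s` the stopped martingale is the average of `F`. Its norm is at
most twice the average of `‖F‖` one level earlier, which had not exceeded `lam`; `h0` ensures that
an earlier level exists. -/
theorem norm_sub_afterExceed_le {N : ℕ} {lam : ℝ} {F : ℕ → V} {x : ℕ}
    (h0 : cexp N 0 (fun y => ‖F y‖) x ≤ lam)
    (hx : ∃ k ≤ N, lam < cexp N k (fun y => ‖F y‖) x) :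
    ‖F x - afterExceed N (fun y => ‖F y‖) lam F x‖ ≤ 2 * lam := by
  classical
  have hx' : ∃ k, k ≤ N ∧ lam < cexp N k (fun y => ‖F y‖) x := hx
  set s := Nat.find hx' with hs
  obtain ⟨hsN, hsx⟩ := Nat.find_spec hx'
  have hmin : ∀ k < s, cexp N k (fun y => ‖F y‖) x ≤ lam := by
    intro k hk
    by_contra hcon
    exact Nat.find_min hx' hk ⟨hk.le.trans hsN, not_le.1 hcon⟩
  have hpos : s ≠ 0 := by
    intro h
    rw [← hs, h] at hsx
    linarith
  have h1 : afterExceed N (fun y => ‖F y‖) lam F x = F x - cexp N s F x := by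
    have := sum_range_ite_sub (fun t => cexp N t F x) s N
    rw [if_pos hsN, cexp_self] at this
    rw [← this]
    refine sum_congr rfl fun t ht => ?_
    congr 1
    unfold exceed
    congr 1
    refine propext ⟨?_, fun h => ⟨s, h, hsx⟩⟩
    rintro ⟨k, hk, hkx⟩
    by_contra hlt
    exact (hmin k (by omega)).not_gt hkx
  rw [h1, sub_sub_cancel]
  obtain ⟨r, hr⟩ := Nat.exists_eq_succ_of_ne_zero hpos
  calc ‖cexp N s F x‖ ≤ cexp N s (fun y => ‖F y‖) x := norm_cexp_le _ _ _ _
    _ ≤ 2 * cexp N r (fun y => ‖F y‖) x := by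
        rw [hr]
        exact cexp_succ_le (by omega) (fun y => norm_nonneg _) x
    _ ≤ 2 * lam := by linarith [hmin r (by omega)]

theorem afterExceed_eq_zero {N : ℕ} {u : ℕ → ℝ} {lam : ℝ} (F : ℕ → V) {x : ℕ}
    (hx : ¬ ∃ k ≤ N, lam < cexp N k u x) : afterExceed N u lam F x = 0 := by
  refine sum_eq_zero fun t ht => ?_
  rw [exceed, if_neg, zero_smul]
  rintro ⟨k, hk, h⟩
  exact hx ⟨k, hk.trans (mem_range.1 ht).le, h⟩

-- The exceptional set decomposes according to the first level `n` of exceedance; each layer is a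
-- union of level-`n` intervals on which the average of `u` is above `lam`.
open Classical in
theorem sum_exceed_nonneg (N : ℕ) (u : ℕ → ℝ) (lam : ℝ) (n : ℕ) :
    0 ≤ ∑ x ∈ range (2 ^ N), if ∃ k < n, lam < cexp N k u x then u x - lam else 0 := by
  induction n with
  | zero => simp
  | succ n ih =>
    -- The indicator of the layer where exceedance happens first at level `n`.
    set c : ℕ → ℝ := fun x =>
      if (¬ ∃ k < n, lam < cexp N k u x) ∧ lam < cexp N n u x then 1 else 0 with hc
    have hlev : IsLevel N n c := by
      intro x z hz
      have h1 : (∃ k < n, lam < cexp N k u (x ^^^ z)) ↔ ∃ k < n, lam < cexp N k u x := by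
        refine exists_congr fun k => and_congr_right fun hk => ?_
        rw [(isLevel_cexp N k u).mono hk.le x z hz]
      have h2 := isLevel_cexp N n u x z hz
      simp only [hc, h1, h2]
    have hsplit : ∀ x, (if ∃ k < n + 1, lam < cexp N k u x then u x - lam else 0) =
        (if ∃ k < n, lam < cexp N k u x then u x - lam else 0) + (c x • u x - c x * lam) := by
      intro x
      have h3 : (∃ k < n + 1, lam < cexp N k u x) ↔
          (∃ k < n, lam < cexp N k u x) ∨ lam < cexp N n u x := by
        constructor
        · rintro ⟨k, hk, h⟩
          rcases Nat.lt_succ_iff_lt_or_eq.1 hk with h' | rfl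
          · exact Or.inl ⟨k, h', h⟩
          · exact Or.inr h
        · rintro (⟨k, hk, h⟩ | h)
          · exact ⟨k, hk.trans n.lt_succ_self, h⟩
          · exact ⟨n, n.lt_succ_self, h⟩
      by_cases h4 : ∃ k < n, lam < cexp N k u x
      · rw [if_pos (h3.2 (Or.inl h4)), if_pos h4]
        simp only [hc]
        rw [if_neg fun h => h.1 h4]
        simp
      · by_cases h5 : lam < cexp N n u x
        · rw [if_pos (h3.2 (Or.inr h5)), if_neg h4]
          simp only [hc]
          rw [if_pos ⟨h4, h5⟩]
          simp
        · rw [if_neg fun h => (h3.1 h).elim h4 h5, if_neg h4]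
          simp only [hc]
          rw [if_neg fun h => h5 h.2]
          simp
    rw [sum_congr rfl fun x _ => hsplit x, sum_add_distrib, sum_sub_distrib,
      ← sum_cexp (k := n) fun x => c x • u x, ← sum_sub_distrib]
    refine add_nonneg ih (sum_nonneg fun x _ => ?_)
    rw [cexp_smul_of_isLevel hlev, smul_eq_mul, ← mul_sub]
    simp only [hc]
    split_ifs with h
    · linarith [h.2]
    · simp

open Classical in
/-- The weak type inequality for the dyadic maximal function, in its truncated form. -/
theorem sum_maximal_le (N : ℕ) {u : ℕ → ℝ} (hu : ∀ x, 0 ≤ u x) {lam : ℝ} (hlam : 0 < lam) :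
    lam / 2 * ∑ x ∈ range (2 ^ N), (if ∃ k ≤ N, lam < cexp N k u x then (1 : ℝ) else 0) ≤
      ∑ x ∈ range (2 ^ N), if lam / 2 < u x then u x else 0 := by
  have h := sum_exceed_nonneg N u lam (N + 1)
  simp only [Nat.lt_succ_iff] at h
  rw [mul_sum, ← sub_nonneg, ← sum_sub_distrib]
  refine h.trans (sum_le_sum fun x _ => ?_)
  have := hu x
  -- On the exceptional set, `u - lam` is at most `-lam / 2`, plus `u` where `u > lam / 2`.
  split_ifs <;> linarith

end stopping

/-! ### The distributional inequality -/

theorem cexp_apply {ι : Type*} [Fintype ι] (N k : ℕ) (F : ℕ → EuclideanSpace ℂ ι) (x : ℕ) (m : ι) :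
    cexp N k F x m = cexp N k (fun y => F y m) x := by
  simp [cexp]

/-- The vector of the values of a finite family of functions. -/
def vec {ι α : Type*} (f : ι → α → ℂ) (x : α) : EuclideanSpace ℂ ι := WithLp.toLp 2 fun m => f m x

theorem norm_vec_sq {ι α : Type*} [Fintype ι] (f : ι → α → ℂ) (x : α) :
    ‖vec f x‖ ^ 2 = ∑ m, ‖f m x‖ ^ 2 := by
  rw [EuclideanSpace.norm_sq_eq]; rfl

/-- The truncations on the right replace separate weak-type and `L^2` bounds, so that one
integration in `lam` suffices instead of interpolation. -/
theorem distribution_sum_wproj_le {ι : Type*} [Fintype ι] {N : ℕ} {A : ι → Set ℕ}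
    (hA : Pairwise fun m m' => Disjoint (A m) (A m')) {b : ι → ℕ} (hb : ∀ m, b m < 2 ^ N)
    (hD : ∀ m, IsBlockUnion {j | b m ^^^ j ∈ A m}) (f : ι → ℕ → ℂ) {lam : ℝ} (hlam : 0 < lam) :
    ∑ x ∈ range (2 ^ N), (if lam < ‖∑ m, wproj N (A m) (f m) x‖ then (1 : ℝ) else 0) ≤
      ∑ x ∈ range (2 ^ N), (10 / lam * (if lam / 2 < ‖vec f x‖ then ‖vec f x‖ else 0) +
        (lam ^ 2)⁻¹ * (if ‖vec f x‖ ≤ lam then ‖vec f x‖ ^ 2 else 0)) := by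
  classical
  set F : ℕ → EuclideanSpace ℂ ι := vec fun m x => (wal N (b m) x : ℂ) * f m x with hF
  have hnorm : ∀ x, ‖F x‖ = ‖vec f x‖ := by
    intro x
    have : ‖F x‖ ^ 2 = ‖vec f x‖ ^ 2 := by
      rw [hF, norm_vec_sq, norm_vec_sq]
      simp only [norm_mul, Complex.norm_real, norm_wal, one_mul]
    exact (pow_left_inj₀ (norm_nonneg _) (norm_nonneg _) two_ne_zero).1 this
  simp only [← hnorm]
  set u : ℕ → ℝ := fun x => ‖F x‖ with hu
  have hmax := sum_maximal_le N (u := u) (fun x => norm_nonneg _) hlam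
  set G : ℕ → EuclideanSpace ℂ ι := fun x => F x - afterExceed N u lam F x with hG
  set g : ι → ℕ → ℂ := fun m x => (wal N (b m) x : ℂ) * G x m with hg
  have hwal : ∀ m x, (wal N (b m) x : ℂ) * (wal N (b m) x : ℂ) = 1 := fun m x => by
    exact_mod_cast congrArg Complex.ofReal (wal_mul_self N (b m) x)
  have hvecg : ∀ x, ‖vec g x‖ = ‖G x‖ := by
    intro x
    have : ‖vec g x‖ ^ 2 = ‖G x‖ ^ 2 := by
      rw [norm_vec_sq, EuclideanSpace.norm_sq_eq]
      simp only [hg, norm_mul, Complex.norm_real, norm_wal, one_mul]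
    exact (pow_left_inj₀ (norm_nonneg _) (norm_nonneg _) two_ne_zero).1 this
  -- By locality, the part of `F` after stopping contributes nothing off the exceptional set, so `f`
  -- may be replaced there by the good family `g`.
  have hoff : ∀ x < 2 ^ N, (¬ ∃ k ≤ N, lam < cexp N k u x) →
      ∑ m, wproj N (A m) (f m) x = ∑ m, wproj N (A m) (g m) x := by
    intro x hx hxo
    refine sum_congr rfl fun m _ => ?_
    rw [wproj_eq_wal_mul (hb m), wproj_eq_wal_mul (hb m) (A m) (g m)]
    congr 1
    have h1 : (fun y => (wal N (b m) y : ℂ) * g m y) = fun y => (wal N (b m) y : ℂ) * f m y -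
        ∑ t ∈ range N, exceed N u lam t y •
          (cexp N (t + 1) (fun z => F z m) y - cexp N t (fun z => F z m) y) := by
      ext y
      simp only [hg, ← mul_assoc, hwal, one_mul, hG, PiLp.sub_apply]
      congr 1
      simp [afterExceed, ← cexp_apply]
    rw [h1, wproj_sub, wproj_martingale_transform (hD m) (isLevel_exceed N u lam) _ hx, sub_zero]
    intro t ht
    rw [exceed, if_neg]
    rintro ⟨k, hk, h⟩
    exact hxo ⟨k, hk.trans ht.le, h⟩
  have hL2 : ∑ x ∈ range (2 ^ N), ‖∑ m, wproj N (A m) (g m) x‖ ^ 2 ≤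
      ∑ x ∈ range (2 ^ N), ‖G x‖ ^ 2 := by
    refine (sum_norm_sq_sum_wproj_le N hA g).trans_eq (sum_congr rfl fun x _ => ?_)
    rw [← norm_vec_sq, hvecg]
  rw [sum_add_distrib, ← mul_sum, ← mul_sum]
  set M := ∑ x ∈ range (2 ^ N), (if ∃ k ≤ N, lam < cexp N k u x then (1 : ℝ) else 0) with hM
  -- The exceptional set is counted once for itself and four times through `‖G‖ ^ 2 ≤ (2 * lam) ^
  -- 2`; the maximal inequality bounds each copy with the factor `2 / lam`.
  have hM5 : 5 * M ≤ 10 / lam * ∑ x ∈ range (2 ^ N), (if lam / 2 < u x then u x else 0) := by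
    rw [div_mul_eq_mul_div, le_div_iff₀ hlam]
    linarith
  have hM0 : 0 ≤ M := sum_nonneg fun x _ => by split_ifs <;> norm_num
  have hS0 : 0 ≤ (lam ^ 2)⁻¹ * ∑ x ∈ range (2 ^ N), (if u x ≤ lam then u x ^ 2 else 0) :=
    mul_nonneg (by positivity) (sum_nonneg fun x _ => by split_ifs <;> positivity)
  by_cases h0 : ∀ x < 2 ^ N, cexp N 0 u x ≤ lam
  · have hGsum : ∑ x ∈ range (2 ^ N), ‖G x‖ ^ 2 ≤ 4 * lam ^ 2 * M +
        ∑ x ∈ range (2 ^ N), (if u x ≤ lam then u x ^ 2 else 0) := by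
      rw [hM, mul_sum, ← sum_add_distrib]
      refine sum_le_sum fun x hxN => ?_
      by_cases hx : ∃ k ≤ N, lam < cexp N k u x
      · rw [if_pos hx, mul_one]
        have h1 : ‖G x‖ ≤ 2 * lam := norm_sub_afterExceed_le (h0 x (mem_range.1 hxN)) hx
        have h2 : 0 ≤ (if u x ≤ lam then u x ^ 2 else 0) := by split_ifs <;> positivity
        nlinarith [norm_nonneg (G x)]
      · have h1 : u x ≤ lam := by
          by_contra hlt
          refine hx ⟨N, le_rfl, ?_⟩
          rw [cexp_self]
          exact not_le.1 hlt
        rw [if_neg hx, if_pos h1]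
        simp only [hG, afterExceed_eq_zero F hx, sub_zero, mul_zero, zero_add]
        exact le_rfl
    have hpt : ∑ x ∈ range (2 ^ N), (if lam < ‖∑ m, wproj N (A m) (f m) x‖ then (1 : ℝ) else 0) ≤
        M + (lam ^ 2)⁻¹ * ∑ x ∈ range (2 ^ N), ‖∑ m, wproj N (A m) (g m) x‖ ^ 2 := by
      rw [hM, mul_sum, ← sum_add_distrib]
      refine sum_le_sum fun x hx => ?_
      have hnn : 0 ≤ (lam ^ 2)⁻¹ * ‖∑ m, wproj N (A m) (g m) x‖ ^ 2 := by positivity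
      by_cases hxo : ∃ k ≤ N, lam < cexp N k u x
      · rw [if_pos hxo]
        split_ifs <;> linarith
      · rw [if_neg hxo, hoff x (mem_range.1 hx) hxo, zero_add]
        split_ifs with h
        · rw [inv_mul_eq_div, le_div_iff₀ (by positivity), one_mul]
          gcongr
        · exact hnn
    have h3 : (lam ^ 2)⁻¹ * ∑ x ∈ range (2 ^ N), ‖∑ m, wproj N (A m) (g m) x‖ ^ 2 ≤
        (lam ^ 2)⁻¹ * (4 * lam ^ 2 * M +
        ∑ x ∈ range (2 ^ N), (if u x ≤ lam then u x ^ 2 else 0)) := by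
      gcongr
      exact hL2.trans hGsum
    rw [mul_add] at h3
    have h4 : (lam ^ 2)⁻¹ * (4 * lam ^ 2 * M) = 4 * M := by field_simp
    linarith
  -- The level-`0` average is constant, so if it exceeds `lam` somewhere then every point is
  -- exceptional and the bound by `M` is trivial.
  · push Not at h0
    obtain ⟨y, hyN, hy⟩ := h0
    have hone : ∑ x ∈ range (2 ^ N),
        (if lam < ‖∑ m, wproj N (A m) (f m) x‖ then (1 : ℝ) else 0) ≤ M := by
      refine sum_le_sum fun x hx => ?_
      have hconst : cexp N 0 u x = cexp N 0 u y := by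
        have := isLevel_cexp N 0 u y (y ^^^ x) (Nat.xor_lt_two_pow hyN (mem_range.1 hx))
        rwa [Nat.xor_xor_cancel_left] at this
      have hex : ∃ k ≤ N, lam < cexp N k u x := ⟨0, Nat.zero_le _, hconst ▸ hy⟩
      rw [if_pos hex]
      split_ifs <;> norm_num
    linarith

/-! ### From the distributional inequality to the strong type inequality -/

theorem integrableOn_ite_lt_rpow {r : ℝ} (hr : -1 < r) {c : ℝ} (hc : 0 ≤ c) :
    IntegrableOn (fun t : ℝ => if t < c then t ^ r else 0) (Set.Ioi 0) ∧
      ∫ t in Set.Ioi (0 : ℝ), (if t < c then t ^ r else 0) = c ^ (r + 1) / (r + 1) := by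
  classical
  have h1 : (fun t : ℝ => if t < c then t ^ r else 0) =
      (Set.Iio c).indicator fun t => t ^ r := by
    ext t; simp [Set.indicator]
  have hset : Set.Ioi (0 : ℝ) ∩ Set.Iio c = Set.Ioo 0 c := rfl
  rw [h1]
  constructor
  · rw [IntegrableOn, integrable_indicator_iff measurableSet_Iio, IntegrableOn,
      Measure.restrict_restrict measurableSet_Iio, Set.inter_comm, hset]
    have := (intervalIntegral.intervalIntegrable_rpow' hr (a := 0) (b := c)).1
    exact this.mono_set Set.Ioo_subset_Ioc_self
  · rw [setIntegral_indicator measurableSet_Iio, hset, ← integral_Ioc_eq_integral_Ioo,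
      ← intervalIntegral.integral_of_le hc, integral_rpow (Or.inl hr),
      Real.zero_rpow (by linarith), sub_zero]

theorem integrableOn_ite_le_rpow {r : ℝ} (hr : r < -1) {c : ℝ} (hc : 0 < c) :
    IntegrableOn (fun t : ℝ => if c ≤ t then t ^ r else 0) (Set.Ioi 0) ∧
      ∫ t in Set.Ioi (0 : ℝ), (if c ≤ t then t ^ r else 0) = -c ^ (r + 1) / (r + 1) := by
  classical
  have h1 : (fun t : ℝ => if c ≤ t then t ^ r else 0) =
      (Set.Ici c).indicator fun t => t ^ r := by
    ext t; simp [Set.indicator]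
  have hset : Set.Ioi (0 : ℝ) ∩ Set.Ici c = Set.Ici c :=
    Set.inter_eq_right.2 fun t ht => hc.trans_le ht
  rw [h1]
  constructor
  · rw [IntegrableOn, integrable_indicator_iff measurableSet_Ici, IntegrableOn,
      Measure.restrict_restrict measurableSet_Ici, Set.inter_comm, hset]
    exact (integrableOn_Ici_iff_integrableOn_Ioi).2 (integrableOn_Ioi_rpow_of_lt hr hc)
  · rw [setIntegral_indicator measurableSet_Ici, hset, integral_Ici_eq_integral_Ioi,
      integral_Ioi_rpow_of_lt hr hc]

/-- The integrand is `10 * u * t ^ (p - 2)` on `t < 2 * u`, integrable at zero because `p > 1`. -/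
theorem integral_distribution_low {p u : ℝ} (hp1 : 1 < p) (hu : 0 ≤ u) :
    IntegrableOn (fun t : ℝ => t ^ (p - 1) * (10 / t * if t / 2 < u then u else 0)) (Set.Ioi 0) ∧
      ∫ t in Set.Ioi (0 : ℝ), t ^ (p - 1) * (10 / t * if t / 2 < u then u else 0) =
        10 * 2 ^ (p - 1) / (p - 1) * u ^ p := by
  obtain ⟨h1, h2⟩ := integrableOn_ite_lt_rpow (r := p - 2) (by linarith) (c := 2 * u) (by linarith)
  have h3 : Set.EqOn (fun t : ℝ => (10 * u) * if t < 2 * u then t ^ (p - 2) else 0)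
      (fun t : ℝ => t ^ (p - 1) * (10 / t * if t / 2 < u then u else 0)) (Set.Ioi 0) := by
    intro t ht
    have ht : 0 < t := ht
    have hpow : t ^ (p - 1) = t ^ (p - 2) * t := by
      rw [← Real.rpow_add_one ht.ne']; congr 1; ring
    have hiff : t / 2 < u ↔ t < 2 * u := by constructor <;> intro h <;> linarith
    simp only [hiff]
    split_ifs
    · rw [hpow]; field_simp
    · simp
  refine ⟨IntegrableOn.congr_fun (h1.const_mul (10 * u)) h3 measurableSet_Ioi, ?_⟩
  rw [← setIntegral_congr_fun measurableSet_Ioi h3, integral_const_mul, h2]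
  have h4 : p - 2 + 1 = p - 1 := by ring
  rw [h4, Real.mul_rpow zero_le_two hu]
  have h5 : u * u ^ (p - 1) = u ^ p := by
    rcases hu.eq_or_lt with rfl | hpos
    · rw [zero_mul, Real.zero_rpow (by linarith)]
    · rw [mul_comm, ← Real.rpow_add_one hpos.ne']; congr 1; ring
  rw [← h5]
  ring

/-- The integrand is `u ^ 2 * t ^ (p - 3)` on `t ≥ u`, integrable at infinity because `p < 2`. -/
theorem integral_distribution_high {p u : ℝ} (hp1 : 1 < p) (hp2 : p < 2) (hu : 0 ≤ u) :
    IntegrableOn (fun t : ℝ => t ^ (p - 1) * ((t ^ 2)⁻¹ * if u ≤ t then u ^ 2 else 0))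
        (Set.Ioi 0) ∧
      ∫ t in Set.Ioi (0 : ℝ), t ^ (p - 1) * ((t ^ 2)⁻¹ * if u ≤ t then u ^ 2 else 0) =
        1 / (2 - p) * u ^ p := by
  rcases hu.eq_or_lt with rfl | hpos
  · simp [Real.zero_rpow (show p ≠ 0 by linarith)]
  obtain ⟨h1, h2⟩ := integrableOn_ite_le_rpow (r := p - 3) (by linarith) hpos
  have h3 : Set.EqOn (fun t : ℝ => u ^ 2 * if u ≤ t then t ^ (p - 3) else 0)
      (fun t : ℝ => t ^ (p - 1) * ((t ^ 2)⁻¹ * if u ≤ t then u ^ 2 else 0)) (Set.Ioi 0) := by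
    intro t ht
    have ht : 0 < t := ht
    have hpow : t ^ (p - 1) = t ^ (p - 3) * t ^ 2 := by
      rw [← Real.rpow_natCast, ← Real.rpow_add ht]; congr 1; push_cast; ring
    dsimp only
    split_ifs
    · rw [hpow]; field_simp
    · simp
  refine ⟨IntegrableOn.congr_fun (h1.const_mul (u ^ 2)) h3 measurableSet_Ioi, ?_⟩
  rw [← setIntegral_congr_fun measurableSet_Ioi h3, integral_const_mul, h2]
  have h5 : u ^ 2 * u ^ (p - 3 + 1) = u ^ p := by
    rw [← Real.rpow_natCast, ← Real.rpow_add hpos]; congr 1; push_cast; ring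
  have h6 : p - 3 + 1 ≠ 0 := by linarith
  have h7 : 2 - p ≠ 0 := by linarith
  rw [← h5]
  field_simp
  ring

theorem integral_distribution_self {p v : ℝ} (hp1 : 1 < p) (hv : 0 ≤ v) :
    IntegrableOn (fun t : ℝ => t ^ (p - 1) * if t < v then 1 else 0) (Set.Ioi 0) ∧
      ∫ t in Set.Ioi (0 : ℝ), t ^ (p - 1) * (if t < v then 1 else 0) = v ^ p / p := by
  obtain ⟨h1, h2⟩ := integrableOn_ite_lt_rpow (r := p - 1) (by linarith) hv
  simp only [mul_ite, mul_one, mul_zero]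
  refine ⟨h1, ?_⟩
  rw [h2, sub_add_cancel]

/-- The constant of the strong type inequality. -/
def strongConst (p : ℝ) : ℝ := p * (10 * 2 ^ (p - 1) / (p - 1) + 1 / (2 - p))

theorem sum_rpow_le_of_distribution {p : ℝ} (hp1 : 1 < p) (hp2 : p < 2) {α : Type*} (s : Finset α)
    {u v : α → ℝ} (hu : ∀ x, 0 ≤ u x) (hv : ∀ x, 0 ≤ v x)
    (h : ∀ t : ℝ, 0 < t → ∑ x ∈ s, (if t < v x then (1 : ℝ) else 0) ≤
      ∑ x ∈ s, (10 / t * (if t / 2 < u x then u x else 0) +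
        (t ^ 2)⁻¹ * (if u x ≤ t then u x ^ 2 else 0))) :
    ∑ x ∈ s, v x ^ p ≤ strongConst p * ∑ x ∈ s, u x ^ p := by
  have hadd : ∀ x, IntegrableOn (fun t : ℝ =>
      t ^ (p - 1) * (10 / t * if t / 2 < u x then u x else 0) +
        t ^ (p - 1) * ((t ^ 2)⁻¹ * if u x ≤ t then u x ^ 2 else 0)) (Set.Ioi 0) := fun x =>
    Integrable.add (integral_distribution_low hp1 (hu x)).1
      (integral_distribution_high hp1 hp2 (hu x)).1
  have hint : ∫ t in Set.Ioi (0 : ℝ), ∑ x ∈ s, t ^ (p - 1) * (if t < v x then (1 : ℝ) else 0) ≤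
      ∫ t in Set.Ioi (0 : ℝ), ∑ x ∈ s, (t ^ (p - 1) * (10 / t * if t / 2 < u x then u x else 0) +
        t ^ (p - 1) * ((t ^ 2)⁻¹ * if u x ≤ t then u x ^ 2 else 0)) := by
    refine setIntegral_mono_on ?_ ?_ measurableSet_Ioi ?_
    · exact integrable_finsetSum _ fun x _ => (integral_distribution_self hp1 (hv x)).1
    · exact integrable_finsetSum _ fun x _ => hadd x
    · intro t ht
      have ht : 0 < t := ht
      simp only [← mul_add, ← mul_sum]
      exact mul_le_mul_of_nonneg_left (h t ht) (Real.rpow_nonneg ht.le _)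
  rw [integral_finsetSum _ fun x _ => (integral_distribution_self hp1 (hv x)).1,
    integral_finsetSum _ fun x _ => hadd x] at hint
  rw [sum_congr rfl fun x _ => (integral_distribution_self hp1 (hv x)).2,
    sum_congr rfl fun x _ => (integral_add (integral_distribution_low hp1 (hu x)).1
        (integral_distribution_high hp1 hp2 (hu x)).1).trans
      (congrArg₂ (· + ·) (integral_distribution_low hp1 (hu x)).2
        (integral_distribution_high hp1 hp2 (hu x)).2)] at hint
  simp only [← add_mul, ← mul_sum, ← sum_div] at hint
  rw [div_le_iff₀ (by linarith)] at hint
  unfold strongConst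
  linarith

/-! ### Splitting an interval of integers into two pieces adapted to its end points -/

theorem testBit_of_mem_block {t j : ℕ} (h1 : 2 ^ t ≤ j) (h2 : j < 2 ^ (t + 1)) :
    j.testBit t = true := by
  by_contra h
  refine h1.not_gt (Nat.lt_pow_two_of_testBit j fun i hi => ?_)
  rcases hi.eq_or_lt with rfl | hlt
  · simpa using h
  · exact Nat.testBit_lt_two_pow (h2.trans_le (Nat.pow_le_pow_right two_pos hlt))

theorem exists_block {j : ℕ} (hj : j ≠ 0) : ∃ t, 2 ^ t ≤ j ∧ j < 2 ^ (t + 1) :=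
  ⟨Nat.log 2 j, Nat.pow_log_le_self 2 hj, Nat.lt_pow_succ_log_self one_lt_two j⟩

/-- The highest bit changed by xor with `j` is bit `t`, and it alone decides the order. Hence
comparing `b ^^^ j` with `b` sees only the dyadic block of `j`. -/
theorem xor_lt_iff_testBit {t j : ℕ} (h1 : 2 ^ t ≤ j) (h2 : j < 2 ^ (t + 1)) (b : ℕ) :
    b ^^^ j < b ↔ b.testBit t = true := by
  have hbit := testBit_of_mem_block h1 h2
  have hhigh : ∀ i, t < i → (b ^^^ j).testBit i = b.testBit i := by
    intro i hi
    rw [Nat.testBit_xor, Nat.testBit_lt_two_pow (h2.trans_le (Nat.pow_le_pow_right two_pos hi)),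
      Bool.xor_false]
  constructor
  · intro h
    by_contra hb
    have hb : b.testBit t = false := by simpa using hb
    refine h.not_gt (Nat.lt_of_testBit t hb ?_ fun i hi => (hhigh i hi).symm)
    rw [Nat.testBit_xor, hb, hbit]; rfl
  · intro hb
    refine Nat.lt_of_testBit t ?_ hb hhigh
    rw [Nat.testBit_xor, hb, hbit]; rfl

theorem size_eq_iff_of_mem_block {t j j' : ℕ} (h1 : 2 ^ t ≤ j) (h2 : j < 2 ^ (t + 1))
    (h : Nat.size j = Nat.size j') : 2 ^ t ≤ j' ∧ j' < 2 ^ (t + 1) := by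
  rw [← Nat.lt_size, ← Nat.size_le, ← h, Nat.lt_size, Nat.size_le]
  exact ⟨h1, h2⟩

theorem isBlockUnion_xor_le (b l : ℕ) : IsBlockUnion {j | b ^^^ j ≤ b ∧ j < 2 ^ l} := by
  rintro j j' h ⟨hle, hlt⟩
  rcases eq_or_ne j 0 with rfl | hj
  · have : j' = 0 := by
      rw [Nat.size_zero] at h
      exact Nat.size_eq_zero.1 h.symm
    subst this
    exact ⟨hle, hlt⟩
  · obtain ⟨t, h1, h2⟩ := exists_block hj
    obtain ⟨h1', h2'⟩ := size_eq_iff_of_mem_block h1 h2 h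
    refine ⟨?_, ?_⟩
    · have hne : b ^^^ j ≠ b := fun he => hj (by
        have := congrArg (b ^^^ ·) he
        simpa using this)
      exact ((xor_lt_iff_testBit h1' h2' b).2
        ((xor_lt_iff_testBit h1 h2 b).1 (lt_of_le_of_ne hle hne))).le
    · rw [← Nat.size_le, ← h, Nat.size_le]
      exact hlt

theorem isBlockUnion_le_xor (a l : ℕ) : IsBlockUnion {j | a ≤ a ^^^ j ∧ j < 2 ^ l} := by
  rintro j j' h ⟨hle, hlt⟩
  rcases eq_or_ne j 0 with rfl | hj
  · have : j' = 0 := by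
      rw [Nat.size_zero] at h
      exact Nat.size_eq_zero.1 h.symm
    subst this
    exact ⟨hle, hlt⟩
  · obtain ⟨t, h1, h2⟩ := exists_block hj
    obtain ⟨h1', h2'⟩ := size_eq_iff_of_mem_block h1 h2 h
    refine ⟨?_, ?_⟩
    · rw [← not_lt, xor_lt_iff_testBit h1' h2', ← xor_lt_iff_testBit h1 h2, not_lt]
      exact hle
    · rw [← Nat.size_le, ← h, Nat.size_le]
      exact hlt

theorem xor_mem_block {t i j : ℕ} (hi : i < 2 ^ t) (h1 : 2 ^ t ≤ j) (h2 : j < 2 ^ (t + 1)) :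
    2 ^ t ≤ i ^^^ j ∧ i ^^^ j < 2 ^ (t + 1) := by
  refine ⟨Nat.ge_two_pow_of_testBit ?_, Nat.xor_lt_two_pow
    (hi.trans (Nat.pow_lt_pow_right one_lt_two t.lt_succ_self)) h2⟩
  rw [Nat.testBit_xor, Nat.testBit_lt_two_pow hi, testBit_of_mem_block h1 h2]
  rfl

theorem xor_lt_of_mem_block {t i j : ℕ} (h1 : 2 ^ t ≤ i) (h2 : i < 2 ^ (t + 1))
    (h1' : 2 ^ t ≤ j) (h2' : j < 2 ^ (t + 1)) : i ^^^ j < 2 ^ t := by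
  by_contra hcon
  have h := testBit_of_mem_block (not_lt.1 hcon) (Nat.xor_lt_two_pow h2 h2')
  rw [Nat.testBit_xor, testBit_of_mem_block h1 h2, testBit_of_mem_block h1' h2'] at h
  exact absurd h (by simp)

/-- With `l` the highest bit where `a` and `b` differ, the interval is cut at the boundary between
the two dyadic intervals of length `2 ^ l` containing `a` and `b`. In the half of `b` only `n ≤ b`
remains a constraint, in the half of `a` only `a ≤ n`. -/
theorem exists_split_Icc {a b : ℕ} (hab : a ≤ b) : ∃ R L : Set ℕ, Disjoint R L ∧
    Set.Icc a b = R ∪ L ∧ IsBlockUnion {j | b ^^^ j ∈ R} ∧ IsBlockUnion {j | a ^^^ j ∈ L} := by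
  rcases hab.eq_or_lt with rfl | hlt
  · refine ⟨{a}, ∅, by simp, by simp, ?_, fun j j' _ h => h.elim⟩
    intro j j' h hj
    have hj0 : j = 0 := by
      have := congrArg (a ^^^ ·) (show a ^^^ j = a from hj)
      simpa using this
    subst hj0
    have : j' = 0 := by
      rw [Nat.size_zero] at h
      exact Nat.size_eq_zero.1 h.symm
    rw [this]
    exact hj
  obtain ⟨l, h1, h2⟩ := exists_block (j := a ^^^ b) (by simpa using hlt.ne)
  have hbl : b.testBit l = true := by
    rw [← xor_lt_iff_testBit h1 h2, Nat.xor_comm a b, Nat.xor_xor_cancel_left]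
    exact hlt
  have hal : ¬ a.testBit l = true := by
    rw [← xor_lt_iff_testBit h1 h2, Nat.xor_xor_cancel_left]
    exact hlt.not_gt
  have hna : ∀ n, n ^^^ a = (n ^^^ b) ^^^ (a ^^^ b) := fun n => by
    rw [Nat.xor_comm a b, Nat.xor_assoc, Nat.xor_xor_cancel_left]
  have hnb : ∀ n, n ^^^ b = (n ^^^ a) ^^^ (a ^^^ b) := fun n => by
    rw [Nat.xor_assoc, Nat.xor_xor_cancel_left]
  have ha' : ∀ n, a ^^^ (n ^^^ a) = n := fun n => by
    rw [Nat.xor_comm n a, Nat.xor_xor_cancel_left]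
  have hb' : ∀ n, b ^^^ (n ^^^ b) = n := fun n => by
    rw [Nat.xor_comm n b, Nat.xor_xor_cancel_left]
  refine ⟨{n | n ≤ b ∧ n ^^^ b < 2 ^ l}, {n | a ≤ n ∧ n ^^^ a < 2 ^ l}, ?_, ?_, ?_, ?_⟩
  · refine Set.disjoint_left.2 ?_
    rintro n ⟨-, hR⟩ ⟨-, hL⟩
    rw [hna] at hL
    exact (xor_mem_block hR h1 h2).1.not_gt hL
  · refine Set.Subset.antisymm ?_ (Set.union_subset ?_ ?_)
    · rintro n ⟨han, hnb'⟩
      -- If `n` first differed from `a` at a bit `t > l`, then `a ≤ n` would force that bit of `a`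
      -- to be `0` and `n ≤ b` would force that bit of `b` to be `1`, although `a` and `b` agree
      -- above `l`.
      have hlt1 : n ^^^ a < 2 ^ (l + 1) := by
        by_contra hge
        have hne : n ^^^ a ≠ 0 := fun h0 => hge (h0 ▸ by positivity)
        obtain ⟨t, ht1, ht2⟩ := exists_block hne
        have hlt : l < t := by
          have : 2 ^ (l + 1) < 2 ^ (t + 1) := (not_lt.1 hge).trans_lt ht2
          have := (Nat.pow_lt_pow_iff_right one_lt_two).1 this
          omega
        have hab_t : a ^^^ b < 2 ^ t := h2.trans_le (Nat.pow_le_pow_right two_pos hlt)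
        have hat : ¬ a.testBit t = true := by
          rw [← xor_lt_iff_testBit ht1 ht2, ha']
          exact not_lt.2 han
        have hblock := xor_mem_block hab_t ht1 ht2
        rw [Nat.xor_comm, ← hnb] at hblock
        have hbt : b.testBit t = true := by
          rw [← xor_lt_iff_testBit hblock.1 hblock.2, hb']
          refine lt_of_le_of_ne hnb' fun he => ?_
          rw [he, Nat.xor_self] at hblock
          exact absurd hblock.1 (by simp)
        have hx := Nat.testBit_lt_two_pow hab_t
        rw [Nat.testBit_xor, hbt] at hx
        simp only [Bool.xor_true, Bool.not_eq_false'] at hx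
        exact hat hx
      by_cases hL : n ^^^ a < 2 ^ l
      · exact Or.inr ⟨han, hL⟩
      · refine Or.inl ⟨hnb', ?_⟩
        rw [hnb]
        exact xor_lt_of_mem_block (not_lt.1 hL) hlt1 h1 h2
    · rintro n ⟨hn, hR⟩
      refine ⟨?_, hn⟩
      have hblock := xor_mem_block hR h1 h2
      rw [← hna] at hblock
      rw [← xor_lt_iff_testBit hblock.1 hblock.2, ha', not_lt] at hal
      exact hal
    · rintro n ⟨hn, hL⟩
      refine ⟨hn, ?_⟩
      have hblock := xor_mem_block hL h1 h2
      rw [← hnb] at hblock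
      rw [← xor_lt_iff_testBit hblock.1 hblock.2, hb'] at hbl
      exact hbl.le
  · have h : {j | b ^^^ j ∈ {n | n ≤ b ∧ n ^^^ b < 2 ^ l}} = {j | b ^^^ j ≤ b ∧ j < 2 ^ l} := by
      ext j
      change (b ^^^ j ≤ b ∧ b ^^^ j ^^^ b < 2 ^ l) ↔ _
      rw [Nat.xor_comm b j, Nat.xor_xor_cancel_right, Nat.xor_comm j b]
      rfl
    rw [h]
    exact isBlockUnion_xor_le b l
  · have h : {j | a ^^^ j ∈ {n | a ≤ n ∧ n ^^^ a < 2 ^ l}} = {j | a ≤ a ^^^ j ∧ j < 2 ^ l} := by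
      ext j
      change (a ≤ a ^^^ j ∧ a ^^^ j ^^^ a < 2 ^ l) ↔ _
      rw [Nat.xor_comm a j, Nat.xor_xor_cancel_right, Nat.xor_comm j a]
      rfl
    rw [h]
    exact isBlockUnion_le_xor a l

/-- Truncation at `2 ^ N` makes infinite intervals finite and keeps both modulating frequencies
inside the group. -/
theorem exists_split_ordConnected {I : Set ℕ} (hI : I.OrdConnected) (N : ℕ) :
    ∃ (R L : Set ℕ) (b a : ℕ), b < 2 ^ N ∧ a < 2 ^ N ∧ Disjoint R L ∧
      I ∩ Set.Iio (2 ^ N) = R ∪ L ∧ IsBlockUnion {j | b ^^^ j ∈ R} ∧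
      IsBlockUnion {j | a ^^^ j ∈ L} := by
  classical
  set J : Finset ℕ := (range (2 ^ N)).filter (· ∈ I) with hJ
  have hmem : ∀ n, n ∈ J ↔ n < 2 ^ N ∧ n ∈ I := fun n => by rw [hJ, mem_filter, mem_range]
  rcases J.eq_empty_or_nonempty with he | hne
  · refine ⟨∅, ∅, 0, 0, by positivity, by positivity, by simp, ?_, fun j j' _ h => h.elim,
      fun j j' _ h => h.elim⟩
    rw [Set.union_empty, Set.eq_empty_iff_forall_notMem]
    rintro n ⟨hn, hlt⟩
    have := (hmem n).2 ⟨hlt, hn⟩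
    rw [he] at this
    exact absurd this (notMem_empty n)
  · have ha := (hmem _).1 (J.min'_mem hne)
    have hb := (hmem _).1 (J.max'_mem hne)
    obtain ⟨R, L, hd, hu, hR, hL⟩ := exists_split_Icc (J.min'_le _ (J.max'_mem hne))
    refine ⟨R, L, _, _, hb.1, ha.1, hd, ?_, hR, hL⟩
    rw [← hu]
    ext n
    constructor
    · rintro ⟨hn, hlt⟩
      exact ⟨J.min'_le n ((hmem n).2 ⟨hlt, hn⟩), J.le_max' n ((hmem n).2 ⟨hlt, hn⟩)⟩
    · rintro ⟨h1, h2⟩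
      exact ⟨hI.out ha.2 hb.2 ⟨h1, h2⟩, lt_of_le_of_lt h2 hb.1⟩

/-! ### The inequality on the dyadic group -/

theorem sum_rpow_norm_sum_wproj_le {p : ℝ} (hp1 : 1 < p) (hp2 : p < 2) {ι : Type*} [Fintype ι]
    {N : ℕ} {A : ι → Set ℕ} (hA : Pairwise fun m m' => Disjoint (A m) (A m')) {b : ι → ℕ}
    (hb : ∀ m, b m < 2 ^ N) (hD : ∀ m, IsBlockUnion {j | b m ^^^ j ∈ A m}) (f : ι → ℕ → ℂ) :
    ∑ x ∈ range (2 ^ N), ‖∑ m, wproj N (A m) (f m) x‖ ^ p ≤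
      strongConst p * ∑ x ∈ range (2 ^ N), ‖vec f x‖ ^ p :=
  sum_rpow_le_of_distribution hp1 hp2 _ (fun _ => norm_nonneg _) (fun _ => norm_nonneg _)
    fun _ ht => distribution_sum_wproj_le hA hb hD f ht

theorem add_rpow_le_two_rpow_mul {p a b : ℝ} (hp : 0 ≤ p) (ha : 0 ≤ a) (hb : 0 ≤ b) :
    (a + b) ^ p ≤ 2 ^ p * (a ^ p + b ^ p) := by
  have h1 : (a + b) ^ p ≤ (2 * max a b) ^ p :=
    Real.rpow_le_rpow (by positivity) (by linarith [le_max_left a b, le_max_right a b]) hp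
  rw [Real.mul_rpow zero_le_two (ha.trans (le_max_left a b))] at h1
  refine h1.trans (mul_le_mul_of_nonneg_left ?_ (by positivity))
  have h2 := Real.rpow_nonneg ha p
  have h3 := Real.rpow_nonneg hb p
  rcases max_choice a b with h | h <;> rw [h] <;> linarith

theorem exists_sum_rpow_norm_sum_le {p : ℝ} (hp1 : 1 < p) (hp2 : p ≤ 2) :
    ∃ K : ℝ≥0, ∀ (N : ℕ) {ι : Type*} [Fintype ι] (I : ι → Set ℕ) (f : ι → ℕ → ℂ),
      (∀ m, (I m).OrdConnected) → Pairwise (fun m m' => Disjoint (I m) (I m')) →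
      (∀ m, ∀ n < 2 ^ N, wcoeff N (f m) n ≠ 0 → n ∈ I m) →
      ∑ x ∈ range (2 ^ N), ‖∑ m, f m x‖ ^ p ≤ K * ∑ x ∈ range (2 ^ N), ‖vec f x‖ ^ p := by
  -- `strongConst` blows up as `p` tends to `2`, so the end point is treated by Parseval, with no
  -- splitting of the intervals.
  rcases hp2.eq_or_lt with rfl | hp2
  · refine ⟨1, fun N ι _ I f _ hdisj hspec => ?_⟩
    have h := sum_norm_sq_sum_wproj_le N hdisj f
    simp only [← norm_vec_sq] at h
    simp only [Real.rpow_two, NNReal.coe_one, one_mul]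
    refine le_trans (le_of_eq (sum_congr rfl fun x hx => ?_)) h
    congr 3
    ext m
    exact (wproj_eq_self (hspec m) (mem_range.1 hx)).symm
  · have hC : 0 ≤ strongConst p := by
      unfold strongConst
      have h1 : 0 < p - 1 := by linarith
      have h2 : 0 < 2 - p := by linarith
      positivity
    refine ⟨⟨2 ^ p * (2 * strongConst p), by positivity⟩, fun N ι _ I f hI hdisj hspec => ?_⟩
    choose R L b a hb ha hd hu hR hL using fun m => exists_split_ordConnected (hI m) N
    have hsub : ∀ m, R m ⊆ I m ∧ L m ⊆ I m := fun m => by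
      have h1 : R m ∪ L m ⊆ I m := hu m ▸ Set.inter_subset_left
      exact ⟨Set.subset_union_left.trans h1, Set.subset_union_right.trans h1⟩
    have hRL : ∀ m, ∀ x ∈ range (2 ^ N),
        f m x = wproj N (R m) (f m) x + wproj N (L m) (f m) x := by
      intro m x hx
      rw [← wproj_union (hd m), ← hu m, wproj_eq_self _ (mem_range.1 hx)]
      intro n hn hc
      exact ⟨hspec m n hn hc, hn⟩
    have h1 := sum_rpow_norm_sum_wproj_le hp1 hp2
      (fun m m' h => (hdisj h).mono (hsub m).1 (hsub m').1) hb hR f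
    have h2 := sum_rpow_norm_sum_wproj_le hp1 hp2
      (fun m m' h => (hdisj h).mono (hsub m).2 (hsub m').2) ha hL f
    calc ∑ x ∈ range (2 ^ N), ‖∑ m, f m x‖ ^ p
        ≤ ∑ x ∈ range (2 ^ N), 2 ^ p * (‖∑ m, wproj N (R m) (f m) x‖ ^ p +
            ‖∑ m, wproj N (L m) (f m) x‖ ^ p) := by
          refine sum_le_sum fun x hx => ?_
          rw [sum_congr rfl fun m _ => hRL m x hx, sum_add_distrib]
          exact (Real.rpow_le_rpow (norm_nonneg _) (norm_add_le _ _) (by linarith)).trans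
            (add_rpow_le_two_rpow_mul (by linarith) (norm_nonneg _) (norm_nonneg _))
      _ ≤ 2 ^ p * (2 * strongConst p) * ∑ x ∈ range (2 ^ N), ‖vec f x‖ ^ p := by
          rw [← mul_sum, sum_add_distrib, mul_assoc]
          gcongr
          linarith

/-! ### Walsh functions on dyadic intervals -/

/-- Value of a Rademacher function inside a dyadic interval. -/
theorem rademacher_succ_of_mem {N k j : ℕ} (hk : k < N) {t : ℝ}
    (ht : t ∈ Set.Ioo ((j : ℝ) / 2 ^ N) ((j + 1) / 2 ^ N)) :
    rademacher (k + 1) t = if j.testBit (N - 1 - k) then -1 else 1 := by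
  set d := N - 1 - k with hd
  set q := j / 2 ^ d with hq
  have hNd : (2 : ℝ) ^ N = 2 ^ (k + 1) * 2 ^ d := by rw [← pow_add]; congr 1; omega
  have hd0 : (0 : ℝ) < 2 ^ d := by positivity
  obtain ⟨h1, h2⟩ := ht
  rw [div_lt_iff₀ (by positivity), hNd] at h1
  rw [lt_div_iff₀ (by positivity), hNd] at h2
  have hql : (q : ℝ) * 2 ^ d ≤ j := by exact_mod_cast Nat.div_mul_le_self j (2 ^ d)
  have hqu : (j : ℝ) + 1 ≤ (q + 1) * 2 ^ d := by
    have h : j + 1 ≤ (q + 1) * 2 ^ d := by rw [add_mul, one_mul]; exact Nat.lt_div_mul_add (by positivity)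
    exact_mod_cast h
  have hy1 : (q : ℝ) < 2 ^ (k + 1) * t := by
    by_contra hcon
    nlinarith [not_lt.1 hcon]
  have hy2 : 2 ^ (k + 1) * t < q + 1 := by
    by_contra hcon
    nlinarith [not_lt.1 hcon]
  have hsin : 0 < Real.sin ((2 ^ (k + 1) * t - q) * Real.pi) :=
    Real.sin_pos_of_pos_of_lt_pi (mul_pos (by linarith) Real.pi_pos)
      (by nlinarith [Real.pi_pos])
  -- Here `q` is the integer part of `2 ^ (k + 1) * t`; its parity gives the sign of the sine and is
  -- the bit `N - 1 - k` of `j`.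
  have heq : Real.sin (2 ^ (k + 1) * Real.pi * t) =
      (-1) ^ q * Real.sin ((2 ^ (k + 1) * t - q) * Real.pi) := by
    rw [← Real.sin_add_nat_mul_pi]
    congr 1
    ring
  rw [rademacher, heq, Nat.testBit_eq_decide_div_mod_eq, ← hq]
  rcases Nat.mod_two_eq_zero_or_one q with h | h
  · rw [(Nat.even_iff.2 h).neg_one_pow, one_mul, Real.sign_of_pos hsin, h]
    simp
  · rw [(Nat.odd_iff.2 h).neg_one_pow, neg_one_mul, Real.sign_of_neg (neg_lt_zero.2 hsin), h]
    simp

theorem walsh_of_mem {N n j : ℕ} (hn : n < 2 ^ N) {t : ℝ}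
    (ht : t ∈ Set.Ioo ((j : ℝ) / 2 ^ N) ((j + 1) / 2 ^ N)) : walsh n t = wal N n j := by
  have hset : n.bitIndices.toFinset = (range N).filter fun i => n.testBit i = true := by
    ext i
    rw [List.mem_toFinset, Nat.mem_bitIndices, mem_filter, mem_range]
    refine ⟨fun h => ⟨?_, h⟩, fun h => h.2⟩
    by_contra hN
    rw [Nat.testBit_lt_two_pow (hn.trans_le (Nat.pow_le_pow_right two_pos (not_lt.1 hN)))] at h
    exact absurd h (by simp)
  unfold walsh wal
  rw [hset, prod_filter]
  refine prod_congr rfl fun i hi => ?_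
  rw [rademacher_succ_of_mem (mem_range.1 hi) ht]
  cases n.testBit i <;> simp

/-! ### Dyadic intervals and averages -/

/-- The `j`-th dyadic interval of length `2 ^ (-N)`. -/
def cell (N j : ℕ) : Set ℝ := Set.Ico ((j : ℝ) / 2 ^ N) ((j + 1) / 2 ^ N)

theorem measurableSet_cell (N j : ℕ) : MeasurableSet (cell N j) := measurableSet_Ico

theorem volume_cell (N j : ℕ) : volume (cell N j) = ((2 : ℝ≥0∞) ^ N)⁻¹ := by
  rw [cell, Real.volume_Ico, ← sub_div, add_sub_cancel_left, ENNReal.ofReal_div_of_pos (by positivity),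
    ENNReal.ofReal_one, ENNReal.ofReal_pow zero_le_two, one_div, ENNReal.ofReal_ofNat]

theorem mem_cell_iff {N j : ℕ} {t : ℝ} : t ∈ cell N j ↔ 0 ≤ t ∧ ⌊2 ^ N * t⌋₊ = j := by
  have h2 : (0 : ℝ) < 2 ^ N := by positivity
  unfold cell
  rw [Set.mem_Ico, div_le_iff₀ h2, lt_div_iff₀ h2]
  constructor
  · rintro ⟨h, h'⟩
    have h0 : 0 ≤ t := by
      by_contra hneg
      nlinarith [(Nat.cast_nonneg j : (0 : ℝ) ≤ j), not_le.1 hneg]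
    refine ⟨h0, (Nat.floor_eq_iff (by positivity)).2 ⟨by linarith, by linarith⟩⟩
  · rintro ⟨h0, h⟩
    obtain ⟨h3, h4⟩ := (Nat.floor_eq_iff (by positivity)).1 h
    exact ⟨by linarith, by linarith⟩

theorem pairwiseDisjoint_cell (N : ℕ) (s : Set ℕ) : s.PairwiseDisjoint (cell N) := by
  intro i _ j _ hij
  refine Set.disjoint_left.2 fun t hi hj => hij ?_
  rw [← (mem_cell_iff.1 hi).2, (mem_cell_iff.1 hj).2]

theorem biUnion_cell (N : ℕ) : ⋃ j ∈ range (2 ^ N), cell N j = Set.Ico (0 : ℝ) 1 := by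
  ext t
  have h2 : (0 : ℝ) < 2 ^ N := by positivity
  simp only [Set.mem_iUnion, mem_cell_iff, mem_range, exists_prop, Set.mem_Ico]
  constructor
  · rintro ⟨j, hj, h0, h⟩
    refine ⟨h0, ?_⟩
    rw [← h, Nat.floor_lt (by positivity)] at hj
    push_cast at hj
    nlinarith
  · rintro ⟨h0, h1⟩
    refine ⟨_, ?_, h0, rfl⟩
    rw [Nat.floor_lt (by positivity)]
    push_cast
    nlinarith

theorem unitMeasure_eq (N : ℕ) :
    unitMeasure = volume.restrict (⋃ j ∈ range (2 ^ N), cell N j) := by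
  rw [biUnion_cell, unitMeasure, Measure.restrict_congr_set Ico_ae_eq_Icc]

instance : IsProbabilityMeasure unitMeasure := ⟨by simp [unitMeasure]⟩

theorem restrict_cell_le {N j : ℕ} (hj : j < 2 ^ N) : volume.restrict (cell N j) ≤ unitMeasure := by
  rw [unitMeasure_eq N]
  exact Measure.restrict_mono_set _ (Set.subset_biUnion_of_mem (u := cell N)
    (show j ∈ range (2 ^ N) from mem_range.2 hj))

theorem lintegral_unitMeasure (N : ℕ) (g : ℝ → ℝ≥0∞) :
    ∫⁻ t, g t ∂unitMeasure = ∑ j ∈ range (2 ^ N), ∫⁻ t in cell N j, g t := by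
  rw [unitMeasure_eq N, lintegral_biUnion_finset (pairwiseDisjoint_cell N _)
    fun j _ => measurableSet_cell N j]

section average

variable {V : Type*} [NormedAddCommGroup V] [NormedSpace ℝ V]

theorem integral_unitMeasure (N : ℕ) {g : ℝ → V} (hg : Integrable g unitMeasure) :
    ∫ t, g t ∂unitMeasure = ∑ j ∈ range (2 ^ N), ∫ t in cell N j, g t := by
  conv_lhs => rw [unitMeasure_eq N]
  rw [integral_biUnion_finset _ (fun j _ => measurableSet_cell N j) (pairwiseDisjoint_cell N _)]
  intro j hj
  exact hg.mono_measure (restrict_cell_le (mem_range.1 hj))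

/-- The average of `F` over a dyadic interval. -/
def cellAvg (N : ℕ) (F : ℝ → V) (j : ℕ) : V := (2 : ℝ) ^ N • ∫ t in cell N j, F t

/-- Jensen's inequality, obtained from the monotonicity of `L^p` norms for the normalized measure on
the cell. -/
theorem enorm_cellAvg_rpow_le {p : ℝ} (hp : 1 ≤ p) {N j : ℕ} (hj : j < 2 ^ N) {F : ℝ → V}
    (hF : AEStronglyMeasurable F unitMeasure) :
    ‖cellAvg N F j‖ₑ ^ p ≤ 2 ^ N * ∫⁻ t in cell N j, ‖F t‖ₑ ^ p := by
  have hp0 : 0 < p := by linarith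
  set μ : Measure ℝ := (2 : ℝ≥0∞) ^ N • volume.restrict (cell N j) with hμ
  have hprob : IsProbabilityMeasure μ := ⟨by
    rw [hμ, Measure.smul_apply, Measure.restrict_apply_univ, volume_cell, smul_eq_mul]
    exact ENNReal.mul_inv_cancel (by positivity) (by finiteness)⟩
  have hFμ : AEStronglyMeasurable F μ :=
    (hF.mono_measure (restrict_cell_le hj)).smul_measure _
  have h1 : cellAvg N F j = ∫ t, F t ∂μ := by
    rw [hμ, integral_smul_measure]
    simp [cellAvg]
  have h2 : ‖cellAvg N F j‖ₑ ≤ (∫⁻ t, ‖F t‖ₑ ^ p ∂μ) ^ (1 / p) := by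
    rw [h1]
    refine (enorm_integral_le_lintegral_enorm F).trans ?_
    have h3 := eLpNorm_le_eLpNorm_of_exponent_le (p := 1) (q := ENNReal.ofReal p)
      (ENNReal.one_le_ofReal.2 hp) hFμ
    rwa [eLpNorm_one_eq_lintegral_enorm, eLpNorm_eq_lintegral_rpow_enorm_toReal (by simpa using hp0)
      ENNReal.ofReal_ne_top, ENNReal.toReal_ofReal hp0.le] at h3
  calc ‖cellAvg N F j‖ₑ ^ p ≤ ((∫⁻ t, ‖F t‖ₑ ^ p ∂μ) ^ (1 / p)) ^ p :=
        ENNReal.rpow_le_rpow h2 hp0.le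
    _ = ∫⁻ t, ‖F t‖ₑ ^ p ∂μ := by
        rw [← ENNReal.rpow_mul, one_div_mul_cancel hp0.ne', ENNReal.rpow_one]
    _ = _ := by rw [hμ, lintegral_smul_measure, smul_eq_mul]

/-- Lebesgue differentiation: a closed cell is a closed ball about its midpoint, not about `t`, so
the version allowing off-centre balls is needed. -/
theorem ae_tendsto_cellAvg [CompleteSpace V] {F : ℝ → V} (hF : Integrable F unitMeasure) :
    ∀ᵐ t ∂unitMeasure, Tendsto (fun N => cellAvg N F ⌊2 ^ N * t⌋₊) atTop (𝓝 (F t)) := by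
  set G : ℝ → V := (Set.Icc (0 : ℝ) 1).indicator F with hG
  have hGint : Integrable G volume := (integrable_indicator_iff measurableSet_Icc).2 hF
  have hmain := IsUnifLocDoublingMeasure.ae_tendsto_average (volume : Measure ℝ)
    hGint.locallyIntegrable 1
  rw [unitMeasure, Measure.restrict_congr_set Ico_ae_eq_Icc.symm]
  filter_upwards [ae_restrict_of_ae hmain, ae_restrict_mem measurableSet_Ico] with t ht ht01
  have hδ : Tendsto (fun N : ℕ => (1 / 2 : ℝ) * (1 / 2) ^ N) atTop (𝓝[>] 0) := by
    rw [tendsto_nhdsWithin_iff]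
    refine ⟨?_, Eventually.of_forall fun N => by simp only [Set.mem_Ioi]; positivity⟩
    simpa using (tendsto_pow_atTop_nhds_zero_of_lt_one (r := (1 / 2 : ℝ)) (by norm_num)
      (by norm_num)).const_mul (1 / 2 : ℝ)
  have hball : ∀ N : ℕ, Metric.closedBall (((⌊2 ^ N * t⌋₊ : ℝ) + 1 / 2) / 2 ^ N)
      ((1 / 2 : ℝ) * (1 / 2) ^ N) =
      Set.Icc ((⌊2 ^ N * t⌋₊ : ℝ) / 2 ^ N) ((⌊2 ^ N * t⌋₊ + 1) / 2 ^ N) := by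
    intro N
    rw [Real.closedBall_eq_Icc, one_div_pow]
    congr 1 <;> ring
  have hlim := ht (fun N : ℕ => ((⌊2 ^ N * t⌋₊ : ℝ) + 1 / 2) / 2 ^ N)
    (fun N : ℕ => (1 / 2 : ℝ) * (1 / 2) ^ N) hδ (Eventually.of_forall fun N => by
      rw [one_mul, hball]
      exact Set.Ico_subset_Icc_self (mem_cell_iff.2 ⟨ht01.1, rfl⟩))
  have hGt : G t = F t := Set.indicator_of_mem (Set.Ico_subset_Icc_self ht01) F
  rw [hGt] at hlim
  refine hlim.congr fun N => ?_
  have hae : (Set.Icc ((⌊2 ^ N * t⌋₊ : ℝ) / 2 ^ N) ((⌊2 ^ N * t⌋₊ + 1) / 2 ^ N) : Set ℝ)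
      =ᵐ[volume] cell N ⌊2 ^ N * t⌋₊ := Ico_ae_eq_Icc.symm
  rw [hball, setAverage_eq, setIntegral_congr_set hae, measureReal_congr hae, measureReal_def,
    volume_cell, cellAvg]
  have hlt : ⌊2 ^ N * t⌋₊ < 2 ^ N := by
    rw [Nat.floor_lt (by have := ht01.1; positivity)]
    push_cast
    nlinarith [ht01.2, show (0 : ℝ) < 2 ^ N by positivity]
  have hsub : cell N ⌊2 ^ N * t⌋₊ ⊆ Set.Icc 0 1 := by
    refine Set.Subset.trans ?_ Set.Ico_subset_Icc_self
    rw [← biUnion_cell N]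
    exact Set.subset_biUnion_of_mem (u := cell N) (mem_coe.2 (mem_range.2 hlt))
  congr 1
  · simp
  · refine setIntegral_congr_fun (measurableSet_cell _ _) fun y hy => ?_
    exact Set.indicator_of_mem (hsub hy) F

end average

/-- For `n < 2 ^ N` the Walsh function is constant on the interior of each cell, so averaging
preserves these coefficients and hence the spectral hypothesis. -/
theorem wcoeff_cellAvg {N n : ℕ} (hn : n < 2 ^ N) {f : ℝ → ℂ} (hf : Integrable f unitMeasure) :
    wcoeff N (cellAvg N f) n = walshCoeff f n := by
  have hcell : ∀ j, volume.restrict (cell N j) =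
      volume.restrict (Set.Ioo ((j : ℝ) / 2 ^ N) ((j + 1) / 2 ^ N)) := fun j =>
    Measure.restrict_congr_set Ioo_ae_eq_Ico.symm
  have hcongr : ∀ j, (fun t => f t * (walsh n t : ℂ)) =ᵐ[volume.restrict (cell N j)]
      fun t => f t * (wal N n j : ℂ) := by
    intro j
    rw [hcell]
    filter_upwards [ae_restrict_mem measurableSet_Ioo] with t ht
    rw [walsh_of_mem hn ht]
  have hint : Integrable (fun t => f t * (walsh n t : ℂ)) unitMeasure := by
    rw [unitMeasure_eq N]
    refine (integrableOn_finset_iUnion).2 fun j hj => ?_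
    refine Integrable.congr ?_ (hcongr j).symm
    exact (hf.mono_measure (restrict_cell_le (mem_range.1 hj))).mul_const _
  rw [walshCoeff, integral_unitMeasure N hint, wcoeff, mul_sum]
  refine sum_congr rfl fun j _ => ?_
  rw [integral_congr_ae (hcongr j), integral_mul_const, cellAvg, Complex.real_smul]
  push_cast
  field_simp

/-! ### The inequality for finite families on the unit interval -/

theorem cellAvg_vec {ι : Type*} [Fintype ι] {N j : ℕ} (hj : j < 2 ^ N) {f : ι → ℝ → ℂ}
    (hf : ∀ m, Integrable (f m) unitMeasure) :
    cellAvg N (vec f) j = vec (fun m => cellAvg N (f m)) j := by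
  ext m
  simp only [cellAvg, PiLp.smul_apply]
  rw [eval_integral_piLp]
  · rfl
  · exact fun m => (hf m).mono_measure (restrict_cell_le hj)

/-- Jensen for the vector-valued function bounds the averaged right-hand sides uniformly in `N`;
almost everywhere convergence and Fatou then recover the left-hand side. -/
theorem lintegral_enorm_sum_rpow_le {p : ℝ} (hp1 : 1 ≤ p) {K : ℝ≥0} {ι : Type*} [Fintype ι]
    {f : ι → ℝ → ℂ} (hf : ∀ m, Integrable (f m) unitMeasure)
    (hK : ∀ N, ∑ x ∈ range (2 ^ N), ‖∑ m, cellAvg N (f m) x‖ ^ p ≤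
      K * ∑ x ∈ range (2 ^ N), ‖vec (fun m => cellAvg N (f m)) x‖ ^ p) :
    ∫⁻ t, ‖∑ m, f m t‖ₑ ^ p ∂unitMeasure ≤ K * ∫⁻ t, ‖vec f t‖ₑ ^ p ∂unitMeasure := by
  have hp0 : 0 < p := by linarith
  have hvec : Integrable (vec f) unitMeasure := Integrable.of_eval_piLp hf
  have hbound : ∀ N, ∫⁻ t, ‖∑ m, cellAvg N (f m) ⌊2 ^ N * t⌋₊‖ₑ ^ p ∂unitMeasure ≤
      K * ∫⁻ t, ‖vec f t‖ₑ ^ p ∂unitMeasure := by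
    intro N
    have hKe : ∑ x ∈ range (2 ^ N), ‖∑ m, cellAvg N (f m) x‖ₑ ^ p ≤
        K * ∑ x ∈ range (2 ^ N), ‖vec (fun m => cellAvg N (f m)) x‖ₑ ^ p := by
      have h := ENNReal.ofReal_le_ofReal (hK N)
      rw [ENNReal.ofReal_mul K.coe_nonneg, ENNReal.ofReal_coe_nnreal,
        ENNReal.ofReal_sum_of_nonneg fun _ _ => by positivity,
        ENNReal.ofReal_sum_of_nonneg fun _ _ => by positivity] at h
      simpa only [← ENNReal.ofReal_rpow_of_nonneg (norm_nonneg _) hp0.le, ofReal_norm] using h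
    rw [lintegral_unitMeasure N]
    calc ∑ j ∈ range (2 ^ N), ∫⁻ t in cell N j, ‖∑ m, cellAvg N (f m) ⌊2 ^ N * t⌋₊‖ₑ ^ p
        = ∑ j ∈ range (2 ^ N), ((2 : ℝ≥0∞) ^ N)⁻¹ * ‖∑ m, cellAvg N (f m) j‖ₑ ^ p := by
          refine sum_congr rfl fun j _ => ?_
          rw [setLIntegral_congr_fun (measurableSet_cell N j)
            (g := fun _ => ‖∑ m, cellAvg N (f m) j‖ₑ ^ p)
            fun t ht => by simp only [(mem_cell_iff.1 ht).2]]
          rw [setLIntegral_const, volume_cell, mul_comm]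
      _ ≤ ((2 : ℝ≥0∞) ^ N)⁻¹ * (K * ∑ j ∈ range (2 ^ N),
            (2 ^ N * ∫⁻ t in cell N j, ‖vec f t‖ₑ ^ p)) := by
          rw [← mul_sum]
          gcongr
          refine hKe.trans ?_
          gcongr with j hj
          rw [← cellAvg_vec (mem_range.1 hj) hf]
          exact enorm_cellAvg_rpow_le hp1 (mem_range.1 hj) hvec.aestronglyMeasurable
      _ = K * ∑ j ∈ range (2 ^ N), ∫⁻ t in cell N j, ‖vec f t‖ₑ ^ p := by
          rw [← mul_sum, mul_left_comm, ← mul_assoc _ ((2 : ℝ≥0∞) ^ N),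
            ENNReal.inv_mul_cancel (by positivity) (by finiteness), one_mul]
      _ = _ := by rw [lintegral_unitMeasure N]
  have hae : ∀ᵐ t ∂unitMeasure, ‖∑ m, f m t‖ₑ ^ p =
      liminf (fun N => ‖∑ m, cellAvg N (f m) ⌊2 ^ N * t⌋₊‖ₑ ^ p) atTop := by
    filter_upwards [ae_all_iff.2 fun m => ae_tendsto_cellAvg (hf m)] with t ht
    refine (Tendsto.liminf_eq ?_).symm
    exact (ENNReal.continuous_rpow_const.tendsto _).comp
      ((tendsto_finsetSum _ fun m _ => ht m).enorm)
  rw [lintegral_congr_ae hae]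
  refine (lintegral_liminf_le fun N => ?_).trans ?_
  · exact (measurable_from_nat (f := fun j => ‖∑ m, cellAvg N (f m) j‖ₑ ^ p)).comp
      (Nat.measurable_floor.comp (measurable_const.mul measurable_id))
  · refine liminf_le_of_le (by isBoundedDefault) fun b hb => ?_
    obtain ⟨N, hN⟩ := hb.exists
    exact hN.trans (hbound N)

theorem enorm_vec_rpow {ι α : Type*} [Fintype ι] (f : ι → α → ℂ) (x : α) (p : ℝ) :
    ‖vec f x‖ₑ ^ p = (∑ m, ‖f m x‖ₑ ^ (2 : ℕ)) ^ (p / 2) := by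
  have h : ‖vec f x‖ₑ ^ (2 : ℕ) = ∑ m, ‖f m x‖ₑ ^ (2 : ℕ) := by
    have := congrArg ENNReal.ofReal (norm_vec_sq f x)
    rw [ENNReal.ofReal_sum_of_nonneg fun _ _ => by positivity] at this
    simpa only [ENNReal.ofReal_pow (norm_nonneg _), ofReal_norm] using this
  rw [← h, ← ENNReal.rpow_natCast, ← ENNReal.rpow_mul]
  congr 1
  push_cast
  ring

theorem exists_lintegral_enorm_finset_sum_le {p : ℝ} (hp1 : 1 < p) (hp2 : p ≤ 2) :
    ∃ K : ℝ≥0, ∀ {ι : Type*} (I : ι → Set ℕ) (f : ι → ℝ → ℂ),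
      (∀ m, (I m).OrdConnected) → Pairwise (fun m m' => Disjoint (I m) (I m')) →
      (∀ m, Integrable (f m) unitMeasure) → (∀ m, walshSpectrum (f m) ⊆ I m) →
      ∀ s : Finset ι, ∫⁻ x, ‖∑ m ∈ s, f m x‖ₑ ^ p ∂unitMeasure ≤
        K * ∫⁻ x, (∑ m ∈ s, ‖f m x‖ₑ ^ (2 : ℕ)) ^ (p / 2) ∂unitMeasure := by
  obtain ⟨K, hK⟩ := exists_sum_rpow_norm_sum_le hp1 hp2
  refine ⟨K, fun I f hI hdisj hf hspec s => ?_⟩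
  have h := lintegral_enorm_sum_rpow_le (p := p) hp1.le (K := K) (f := fun m : s => f m)
    (fun m => hf m) fun N => hK N (fun m : s => I m) (fun m => cellAvg N (f m)) (fun m => hI m)
      (fun m m' hne => hdisj (Subtype.coe_injective.ne hne)) fun m n hn hc => by
        rw [wcoeff_cellAvg hn (hf m)] at hc
        exact hspec m hc
  simp only [enorm_vec_rpow] at h
  have h1 : ∀ x, ∑ m : s, f m x = ∑ m ∈ s, f m x := fun x => sum_coe_sort s fun m => f m x
  have h2 : ∀ x, ∑ m : s, ‖f m x‖ₑ ^ (2 : ℕ) = ∑ m ∈ s, ‖f m x‖ₑ ^ (2 : ℕ) := fun x =>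
    sum_coe_sort s fun m => ‖f m x‖ₑ ^ (2 : ℕ)
  simpa only [h1, h2] using h

/-! ### Infinite families -/

theorem eLpNorm_ofReal {p : ℝ} (hp : 0 < p) (g : ℝ → ℂ) :
    eLpNorm g (ENNReal.ofReal p) unitMeasure = (∫⁻ x, ‖g x‖ₑ ^ p ∂unitMeasure) ^ (1 / p) := by
  rw [eLpNorm_eq_lintegral_rpow_enorm_toReal (by simpa using hp) ENNReal.ofReal_ne_top,
    ENNReal.toReal_ofReal hp.le]

/-- Dominated convergence along finite subsets, with the full square function as majorant; the tails
vanish wherever it is finite. -/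
theorem tendsto_lintegral_tail {ι : Type*} [Countable ι] {f : ι → ℝ → ℂ}
    (hf : ∀ m, AEStronglyMeasurable (f m) unitMeasure) {p : ℝ} (hp : 0 < p)
    (hfin : ∫⁻ x, (∑' m, ‖f m x‖ₑ ^ (2 : ℕ)) ^ (p / 2) ∂unitMeasure ≠ ∞) :
    Tendsto (fun s : Finset ι => ∫⁻ x, (∑' m : {m // m ∉ s}, ‖f m x‖ₑ ^ (2 : ℕ)) ^ (p / 2)
      ∂unitMeasure) atTop (𝓝 0) := by
  have hp2 : 0 < p / 2 := by linarith
  have hae : ∀ᵐ x ∂unitMeasure, ∀ m, f m x = (hf m).mk (f m) x :=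
    ae_all_iff.2 fun m => (hf m).ae_eq_mk
  have hmeas : Measurable fun x => (∑' m, ‖(hf m).mk (f m) x‖ₑ ^ (2 : ℕ)) ^ (p / 2) :=
    (Measurable.tsum fun m =>
      (hf m).stronglyMeasurable_mk.measurable.enorm.pow_const 2).pow_const _
  have htail : ∀ s : Finset ι,
      ∫⁻ x, (∑' m : {m // m ∉ s}, ‖f m x‖ₑ ^ (2 : ℕ)) ^ (p / 2) ∂unitMeasure =
      ∫⁻ x, (∑' m : {m // m ∉ s}, ‖(hf m).mk (f m) x‖ₑ ^ (2 : ℕ)) ^ (p / 2) ∂unitMeasure :=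
    fun s => lintegral_congr_ae (hae.mono fun x hx => by simp only [hx])
  have hall : ∫⁻ x, (∑' m, ‖(hf m).mk (f m) x‖ₑ ^ (2 : ℕ)) ^ (p / 2) ∂unitMeasure ≠ ∞ := by
    have h : ∫⁻ x, (∑' m, ‖f m x‖ₑ ^ (2 : ℕ)) ^ (p / 2) ∂unitMeasure =
        ∫⁻ x, (∑' m, ‖(hf m).mk (f m) x‖ₑ ^ (2 : ℕ)) ^ (p / 2) ∂unitMeasure :=
      lintegral_congr_ae (hae.mono fun x hx => by simp only [hx])
    rwa [← h]
  simp only [htail]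
  rw [← lintegral_zero (μ := unitMeasure)]
  refine tendsto_lintegral_filter_of_dominated_convergence
    (fun x => (∑' m, ‖(hf m).mk (f m) x‖ₑ ^ (2 : ℕ)) ^ (p / 2)) ?_ ?_ hall ?_
  · exact Eventually.of_forall fun s => (Measurable.tsum fun m : {m // m ∉ s} =>
      (hf m).stronglyMeasurable_mk.measurable.enorm.pow_const 2).pow_const _
  · refine Eventually.of_forall fun s => Eventually.of_forall fun x => ?_
    exact ENNReal.rpow_le_rpow (ENNReal.tsum_comp_le_tsum_of_injective Subtype.coe_injective _)
      hp2.le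
  · filter_upwards [ae_lt_top hmeas hall] with x hx
    have hne : ∑' m, ‖(hf m).mk (f m) x‖ₑ ^ (2 : ℕ) ≠ ∞ := fun h => by
      rw [h, ENNReal.top_rpow_of_pos hp2] at hx
      exact lt_irrefl _ hx
    have h := (ENNReal.continuous_rpow_const (y := p / 2)).tendsto 0 |>.comp
      (ENNReal.tendsto_tsum_compl_atTop_zero hne)
    rwa [ENNReal.zero_rpow_of_pos hp2] at h

end

end DyadicWalsh

/-! ### Unconditional convergence in `L^p` and the norm bound -/

open DyadicWalsh in
theorem theorem1 (p : ℝ) (hp1 : 1 < p) (hp2 : p ≤ 2) :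
    ∃ C : ℝ≥0, ∀ (ι : Type*) [Countable ι] (I : ι → Set ℕ) (f : ι → ℝ → ℂ),
      (∀ m, (I m).OrdConnected) →
      Pairwise (fun m m' => Disjoint (I m) (I m')) →
      (∀ m, AEStronglyMeasurable (f m) unitMeasure) →
      mixedNorm p f < ∞ →
      (∀ m, walshSpectrum (f m) ⊆ I m) →
      ∃ F : ℝ → ℂ, MemLp F (ENNReal.ofReal p) unitMeasure ∧
        Tendsto (fun s : Finset ι =>
          eLpNorm (fun x => (∑ m ∈ s, f m x) - F x) (ENNReal.ofReal p) unitMeasure)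
          atTop (𝓝 0) ∧
        eLpNorm F (ENNReal.ofReal p) unitMeasure ≤ C * mixedNorm p f := by
  classical
  have hp0 : 0 < p := by linarith
  have hp20 : 0 < p / 2 := by linarith
  have hinv : 0 < 1 / p := by positivity
  obtain ⟨K, hK⟩ := exists_lintegral_enorm_finset_sum_le hp1 hp2
  refine ⟨K ^ (1 / p), fun ι _ I f hI hdisj hf hnorm hspec => ?_⟩
  rw [ENNReal.coe_rpow_of_nonneg _ hinv.le]
  have hfin : ∫⁻ x, (∑' m, ‖f m x‖ₑ ^ (2 : ℕ)) ^ (p / 2) ∂unitMeasure ≠ ∞ := fun h => by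
    rw [mixedNorm, h, ENNReal.top_rpow_of_pos hinv] at hnorm
    exact lt_irrefl _ hnorm
  have hmem : ∀ m, MemLp (f m) (ENNReal.ofReal p) unitMeasure := by
    refine fun m => ⟨hf m, lt_of_le_of_lt ?_ hnorm⟩
    rw [eLpNorm_ofReal hp0]
    refine ENNReal.rpow_le_rpow (lintegral_mono fun x => ?_) hinv.le
    calc ‖f m x‖ₑ ^ p = (‖f m x‖ₑ ^ (2 : ℕ)) ^ (p / 2) := by
          rw [← ENNReal.rpow_natCast, ← ENNReal.rpow_mul]
          congr 1
          push_cast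
          ring
      _ ≤ _ := ENNReal.rpow_le_rpow (ENNReal.le_tsum m) hp20.le
  have hone : (1 : ℝ≥0∞) ≤ ENNReal.ofReal p := ENNReal.one_le_ofReal.2 hp1.le
  have : Fact ((1 : ℝ≥0∞) ≤ ENNReal.ofReal p) := ⟨hone⟩
  have hbound : ∀ s : Finset ι, eLpNorm (fun x => ∑ m ∈ s, f m x) (ENNReal.ofReal p) unitMeasure ≤
      (K : ℝ≥0∞) ^ (1 / p) *
        (∫⁻ x, (∑ m ∈ s, ‖f m x‖ₑ ^ (2 : ℕ)) ^ (p / 2) ∂unitMeasure) ^ (1 / p) := by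
    intro s
    rw [eLpNorm_ofReal hp0, ← ENNReal.mul_rpow_of_nonneg _ _ hinv.le]
    exact ENNReal.rpow_le_rpow
      (hK I f hI hdisj (fun m => (hmem m).integrable hone) hspec s) hinv.le
  set g : ι → Lp ℂ (ENNReal.ofReal p) unitMeasure := fun m => (hmem m).toLp (f m) with hg
  have hcoe : ∀ s : Finset ι, ⇑(∑ m ∈ s, g m) =ᵐ[unitMeasure] fun x => ∑ m ∈ s, f m x := by
    intro s
    have h1 : ∀ᵐ x ∂unitMeasure, ∀ m ∈ s, g m x = f m x :=
      (ae_ball_iff s.countable_toSet).2 fun m _ => (hmem m).coeFn_toLp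
    filter_upwards [Lp.coeFn_finsetSum s g, h1] with x hx hx1
    rw [hx, Finset.sum_apply]
    exact Finset.sum_congr rfl hx1
  have henorm : ∀ s : Finset ι, ‖∑ m ∈ s, g m‖ₑ =
      eLpNorm (fun x => ∑ m ∈ s, f m x) (ENNReal.ofReal p) unitMeasure := fun s => by
    rw [Lp.enorm_def, eLpNorm_congr_ae (hcoe s)]
  have htail : Tendsto (fun s : Finset ι => (K : ℝ≥0∞) ^ (1 / p) *
      (∫⁻ x, (∑' m : {m // m ∉ s}, ‖f m x‖ₑ ^ (2 : ℕ)) ^ (p / 2) ∂unitMeasure) ^ (1 / p))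
      atTop (𝓝 0) := by
    have h := ENNReal.Tendsto.const_mul (a := (K : ℝ≥0∞) ^ (1 / p))
      (((ENNReal.continuous_rpow_const (y := 1 / p)).tendsto 0).comp
        (tendsto_lintegral_tail hf hp0 hfin))
      (Or.inr (ENNReal.rpow_ne_top_of_nonneg hinv.le ENNReal.coe_ne_top))
    rwa [ENNReal.zero_rpow_of_pos hinv, mul_zero] at h
  -- Cauchy criterion: a finite sum over indices outside `s` is bounded by the tail of the square
  -- function beyond `s`. Convergence along the directed set of finite subsets is the unconditional
  -- convergence required.
  have hsum : Summable g := by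
    rw [summable_iff_vanishing_norm]
    intro ε hε
    obtain ⟨s, hs⟩ := (htail.eventually_lt_const (ENNReal.ofReal_pos.2 hε)).exists
    refine ⟨s, fun t hts => ?_⟩
    rw [← ENNReal.ofReal_lt_ofReal_iff hε, ofReal_norm, henorm]
    refine ((hbound t).trans ?_).trans_lt hs
    gcongr with x
    have hsub : ∀ m ∈ t, m ∉ s := fun m hm => Finset.disjoint_left.1 hts hm
    rw [← Finset.sum_subtype_of_mem (fun m => ‖f m x‖ₑ ^ (2 : ℕ)) hsub]
    exact ENNReal.sum_le_tsum _
  refine ⟨⇑(∑' m, g m), Lp.memLp _, ?_, ?_⟩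
  · have h := (Lp.tendsto_Lp_iff_tendsto_eLpNorm' _ _).1 hsum.hasSum
    refine h.congr fun s => eLpNorm_congr_ae ?_
    filter_upwards [hcoe s] with x hx
    rw [Pi.sub_apply, hx]
  · rw [← Lp.enorm_def]
    refine le_of_tendsto hsum.hasSum.enorm (Eventually.of_forall fun s => ?_)
    rw [henorm, mixedNorm]
    refine (hbound s).trans ?_
    gcongr with x
    exact ENNReal.sum_le_tsum s
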